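/- Let $d\ge 1$ and $\Omega=[0,1]^d$. Let $V\in C^2(\Omega)$ be $\lambda$-convex, i.e. $\nabla^2V\ge\lambda$ on $\Omega$, for some $\lambda>0$, and separable: $V(x)=V^{[1]}(x_1)+\dots+V^{[d]}(x_d)$ on $\Omega$. Let $W=|\nabla V|^2-2\Delta V$ on $\Omega$. Put $\pi=e^{-V}/\int_\Omega e^{-V}\,dx$ and $\mathcal H(w)=\int_\Omega w\log(w/\pi)\,dx$. Discretization: let $N\ge1$, $h=1/N$ and $J^h=\{1,\dots,N\}^d$; write $\mathbf i\sim\mathbf j$ if $|\mathbf i-\mathbf j|=1$. To $U\in\mathbb R^{J^h}$ associate the piecewise constant function $u^h=U_{\mathbf j}$ on $\prod_k(h(j_k-1),hj_k)$. Let $\mathcal P_+(J^h)=\{U\in(0,\infty)^{J^h}: h^d\sum_{\mathbf j}U_{\mathbf j}=1\}$. Tangent and cotangent vectors are the vectors in $\mathbb R^{J^h}$ of zero mean, with the pairing $P[\Xi]=h^d\sum_{\mathbf j}P_{\mathbf j}\Xi_{\mathbf j}$. Set $$V^{[k],h}_j=\frac1h\int_{h(j-1)}^{hj}V^{[k]}(r)\,dr,\qquad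 \Pi^h_{\mathbf j}=\prod_{k=1}^d\frac{e^{-V^{[k],h}_{j_k}}}{h\sum_{l=1}^Ne^{-V^{[k],h}_l}},$$ let $\pi^h$ be the piecewise constant function associated to $\Pi^h$, and define, for $U\in\mathcal P_+(J^h)$, the Onsager operator $\mathbf K^h_U$ by $$P[\mathbf K^h_UQ]=h^d\sum_{\{\mathbf i,\mathbf j\}:\ \mathbf i\sim\mathbf j}\sqrt{\Pi^h_{\mathbf i}\Pi^h_{\mathbf j}}\;\Lambda\Big(\frac{U_{\mathbf i}}{\Pi^h_{\mathbf i}},\frac{U_{\mathbf j}}{\Pi^h_{\mathbf j}}\Big)\frac{P_{\mathbf i}-P_{\mathbf j}}h\,\frac{Q_{\mathbf i}-Q_{\mathbf j}}h,$$ each edge being counted once, where $\Lambda(a,b)=\frac{a-b}{\log a-\log b}$ for $a\ne b$ and $\Lambda(a,a)=a$. The discrete entropy and the discrete Fisher information on $\mathcal P_+(J^h)$ are $$\mathcal H^h(u^h)=\mathcal H(u^h)-\mathcal H(\pi^h),\qquad \mathcal I^h(u^h)=\mathrm D_{u^h}\mathcal H^h\big[\mathbf K^h_{u^h}\mathrm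 D_{u^h}\mathcal H^h\big].$$ Finally, let $\lambda^h=\frac2{h^2}\big(1-e^{-h^2\lambda/2}\big)$. Theorem. For every $N\ge1$ and $h=1/N$, every solution $u^h:[0,\infty)\to\mathcal P_+(J^h)$ of the gradient flow $\partial_tu^h=-\mathbf K^h_{u^h}\mathrm D_{u^h}\mathcal I^h$ satisfies $$\mathcal H^h(u^h_t)\le\mathcal H^h(u^h_{t'})\,e^{-(2\lambda^h)^2(t-t')}\quad\text{and}\quad\mathcal I^h(u^h_t)\le\mathcal I^h(u^h_{t'})\,e^{-(2\lambda^h)^2(t-t')}\qquad\text{for all }t\ge t'\ge0,$$ $$\mathcal I^h(u^h_t)\le\mathcal H^h(u^h_0)\,(2\lambda^ht)^{-1}\qquad\text{for all }t>0,$$ $$\|u^h_t-\pi^h\|_{L^1(\Omega)}\le\sqrt{2\mathcal H^h(u^h_0)}\;e^{-2(\lambda^h)^2t}\qquad\text{for all }t\ge0.$$ Moreover, $\lambda^h=\lambda+O(h^2)$ as $h\downarrow0$. -/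

import Mathlib

open MeasureTheory

noncomputable section

namespace QDD

/-- The closed unit cube `[0,1]^d`. -/
def unitCube (d : ℕ) : Set (EuclideanSpace ℝ (Fin d)) :=
  {x | ∀ k, x k ∈ Set.Icc (0 : ℝ) 1}

/-! ### The continuous objects -/

section Continuous

variable {d : ℕ}

/-- `lam`-convexity of a twice differentiable potential on the cube: `∇²V ≥ lam`. -/
def IsLambdaConvex (V : EuclideanSpace ℝ (Fin d) → ℝ) (lam : ℝ) : Prop :=
  ∀ x ∈ unitCube d, ∀ ξ : EuclideanSpace ℝ (Fin d),
    lam * ‖ξ‖ ^ 2 ≤ iteratedFDerivWithin ℝ 2 V (unitCube d) x ![ξ, ξ]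

/-- The relation `W = |∇V|² - 2 ΔV` on the cube. -/
def PotentialsRelated (V W : EuclideanSpace ℝ (Fin d) → ℝ) : Prop :=
  ∀ x ∈ unitCube d,
    W x = ‖gradientWithin V (unitCube d) x‖ ^ 2
      - 2 * InnerProductSpace.laplacianWithin V (unitCube d) x

/-- Separability `V(x) = V₁(x₁) + ⋯ + V_d(x_d)` on the cube. -/
def IsSeparable (V : EuclideanSpace ℝ (Fin d) → ℝ) (Vk : Fin d → ℝ → ℝ) : Prop :=
  ∀ x ∈ unitCube d, V x = ∑ k, Vk k (x k)

/-- The partition function `Z = ∫_Ω e^{-V}`. -/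
def partitionZ (V : EuclideanSpace ℝ (Fin d) → ℝ) : ℝ :=
  ∫ x in unitCube d, Real.exp (-V x)

/-- The steady state `π = e^{-V} / Z`. -/
def steadyState (V : EuclideanSpace ℝ (Fin d) → ℝ) (x : EuclideanSpace ℝ (Fin d)) : ℝ :=
  Real.exp (-V x) / partitionZ V

/-- The relative entropy `∫_Ω w log (w / π)`. -/
def entropy (V : EuclideanSpace ℝ (Fin d) → ℝ) (w : EuclideanSpace ℝ (Fin d) → ℝ) : ℝ :=
  ∫ x in unitCube d, w x * Real.log (w x / steadyState V x)

end Continuous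

/-! ### The finite-volume grid with `N` cells per direction; indices start at `0` -/

/-- The mesh width `h = 1 / N`. -/
def mesh (N : ℕ) : ℝ := 1 / (N : ℝ)

/-- The set of multi-indices. -/
abbrev Idx (d N : ℕ) : Type := Fin d → Fin N

/-- Two multi-indices are neighbours if their Euclidean distance is one. -/
def Nbh {d N : ℕ} (i j : Idx d N) : Prop :=
  ∑ k, (((i k : ℕ) : ℤ) - ((j k : ℕ) : ℤ)) ^ 2 = 1

instance {d N : ℕ} (i j : Idx d N) : Decidable (Nbh i j) := by
  unfold Nbh; infer_instance

theorem Nbh.symm {d N : ℕ} {i j : Idx d N} (hij : Nbh i j) : Nbh j i := by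
  unfold Nbh at *
  rw [← hij]
  exact Finset.sum_congr rfl fun k _ => by ring

/-- The open sub-cube of side length `h` with label `j`. -/
def cell {d : ℕ} (N : ℕ) (j : Idx d N) : Set (EuclideanSpace ℝ (Fin d)) :=
  {x | ∀ k, x k ∈ Set.Ioo (mesh N * ((j k : ℕ) : ℝ)) (mesh N * (((j k : ℕ) : ℝ) + 1))}

/-- The function on the cube that equals `U j` on the `j`-th cell
(the value on the interfaces, a null set, is irrelevant). -/
def pcFun {d N : ℕ} (U : Idx d N → ℝ) (x : EuclideanSpace ℝ (Fin d)) : ℝ :=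
  ∑ j, (cell N j).indicator (fun _ => U j) x

/-- Strictly positive probability densities on the grid. -/
def PPos (d N : ℕ) : Set (Idx d N → ℝ) :=
  {U | (∀ j, 0 < U j) ∧ mesh N ^ d * ∑ j, U j = 1}

/-- The pairing of cotangent and tangent vectors. -/
def pairing {d N : ℕ} (P Ξ : Idx d N → ℝ) : ℝ := mesh N ^ d * ∑ j, P j * Ξ j

/-- The cell averages of a one-dimensional potential. -/
def avgV (N : ℕ) (v : ℝ → ℝ) (j : Fin N) : ℝ :=
  1 / mesh N * ∫ r in (mesh N * ((j : ℕ) : ℝ))..(mesh N * (((j : ℕ) : ℝ) + 1)), v r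

/-- The normalization constant of the one-dimensional discrete steady state. -/
def discreteZ (N : ℕ) (v : ℝ → ℝ) : ℝ :=
  mesh N * ∑ j : Fin N, Real.exp (-avgV N v j)

/-- The one-dimensional discrete steady state. -/
def discretePi1 (N : ℕ) (v : ℝ → ℝ) (j : Fin N) : ℝ :=
  Real.exp (-avgV N v j) / discreteZ N v

/-- The discrete steady state on the grid, a product. -/
def discretePi {d : ℕ} (N : ℕ) (Vk : Fin d → ℝ → ℝ) (j : Idx d N) : ℝ :=
  ∏ k, discretePi1 N (Vk k) (j k)

/-- The logarithmic mean of two positive numbers. -/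
def logMean (a b : ℝ) : ℝ :=
  if a = b then a else (a - b) / (Real.log a - Real.log b)

/-- The weight of an edge of the grid in the Onsager operator at `U`. -/
def edgeWeight {d N : ℕ} (Vk : Fin d → ℝ → ℝ) (U : Idx d N → ℝ) (i j : Idx d N) : ℝ :=
  Real.sqrt (discretePi N Vk i * discretePi N Vk j) *
    logMean (U i / discretePi N Vk i) (U j / discretePi N Vk j)

/-- The bilinear form of the Onsager operator. The sum over edges, each counted once, is one half
of the sum over all ordered pairs of neighbours. -/
def onsagerForm {d N : ℕ} (Vk : Fin d → ℝ → ℝ) (U P Q : Idx d N → ℝ) : ℝ :=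
  mesh N ^ d * ((1 / 2) * ∑ i, ∑ j, if Nbh i j then
    edgeWeight Vk U i j * ((P i - P j) / mesh N) * ((Q i - Q j) / mesh N) else 0)

/-- The discrete Onsager operator, i.e. the operator into vectors of zero mean that is represented
by `onsagerForm`, see `pairing_onsager` and `sum_onsager`. -/
def onsager {d N : ℕ} (Vk : Fin d → ℝ → ℝ) (U Q : Idx d N → ℝ) (i : Idx d N) : ℝ :=
  ∑ j, if Nbh i j then edgeWeight Vk U i j * ((Q i - Q j) / mesh N ^ 2) else 0

theorem logMean_comm (a b : ℝ) : logMean a b = logMean b a := by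
  unfold logMean
  by_cases hab : a = b
  · simp [hab]
  · rw [if_neg hab, if_neg (Ne.symm hab), ← neg_sub b a, ← neg_sub (Real.log b) (Real.log a),
      neg_div_neg_eq]

theorem edgeWeight_comm {d N : ℕ} (Vk : Fin d → ℝ → ℝ) (U : Idx d N → ℝ) (i j : Idx d N) :
    edgeWeight Vk U i j = edgeWeight Vk U j i := by
  unfold edgeWeight
  rw [logMean_comm, mul_comm (discretePi N Vk i)]

/-- The Onsager operator represents its bilinear form. -/
theorem pairing_onsager {d N : ℕ} (Vk : Fin d → ℝ → ℝ) (U P Q : Idx d N → ℝ) :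
    pairing P (onsager Vk U Q) = onsagerForm Vk U P Q := by
  have key : ∑ i, P i * onsager Vk U Q i = ∑ i, ∑ j, if Nbh i j then
      P i * (edgeWeight Vk U i j * ((Q i - Q j) / mesh N ^ 2)) else 0 := by
    refine Finset.sum_congr rfl fun i _ => ?_
    rw [onsager, Finset.mul_sum]
    exact Finset.sum_congr rfl fun j _ => by split_ifs <;> simp
  have key2 : ∑ i, P i * onsager Vk U Q i = ∑ i, ∑ j, if Nbh i j then
      -(P j * (edgeWeight Vk U i j * ((Q i - Q j) / mesh N ^ 2))) else 0 := by
    rw [key, Finset.sum_comm]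
    refine Finset.sum_congr rfl fun j _ => Finset.sum_congr rfl fun i _ => ?_
    by_cases hij : Nbh i j
    · rw [if_pos hij, if_pos hij.symm, edgeWeight_comm]; ring
    · rw [if_neg hij, if_neg fun hc => hij hc.symm]
  have key3 : ∑ i, P i * onsager Vk U Q i = (1 / 2) * (∑ i, P i * onsager Vk U Q i +
      ∑ i, P i * onsager Vk U Q i) := by ring
  unfold pairing onsagerForm
  rw [key3]
  nth_rewrite 1 [key]
  rw [key2]
  simp only [← Finset.sum_add_distrib]
  congr 2
  refine Finset.sum_congr rfl fun i _ => Finset.sum_congr rfl fun j _ => ?_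
  split_ifs
  · ring
  · ring

/-- The Onsager operator maps into vectors of zero mean. -/
theorem sum_onsager {d N : ℕ} (Vk : Fin d → ℝ → ℝ) (U Q : Idx d N → ℝ) :
    mesh N ^ d * ∑ i, onsager Vk U Q i = 0 := by
  have := pairing_onsager Vk U (fun _ => 1) Q
  simpa [pairing, onsagerForm] using this

/-- The differential at `U` of a functional on the positive densities, as a cotangent vector: the
vector `P` of zero mean with `pairing P Ξ = D_U F[Ξ]` for all tangent vectors `Ξ` (zero mean).
Its `j`-th entry is `h⁻ᵈ` times the derivative in the direction of the projection of the
`j`-th unit vector to the vectors of zero mean. -/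
def differential {d N : ℕ} (F : (Idx d N → ℝ) → ℝ) (U : Idx d N → ℝ) (j : Idx d N) : ℝ :=
  (mesh N ^ d)⁻¹ * lineDeriv ℝ F U (Pi.single j 1 - fun _ => mesh N ^ d)

/-- The discrete entropy: the restriction of the entropy to piecewise constant densities, shifted
by its value at the discrete steady state. -/
def entropyH {d N : ℕ} (V : EuclideanSpace ℝ (Fin d) → ℝ) (Vk : Fin d → ℝ → ℝ)
    (U : Idx d N → ℝ) : ℝ :=
  entropy V (pcFun U) - entropy V (pcFun (discretePi N Vk))

/-- The discrete Fisher information `D_U H [K_U D_U H]`. -/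
def fisherH {d N : ℕ} (V : EuclideanSpace ℝ (Fin d) → ℝ) (Vk : Fin d → ℝ → ℝ)
    (U : Idx d N → ℝ) : ℝ :=
  pairing (differential (entropyH V Vk) U) (onsager Vk U (differential (entropyH V Vk) U))

/-- A solution, defined for all times `t ≥ 0`, of the gradient flow `∂ₜ U = - K_U D_U I` of the
discrete Fisher information in the space of strictly positive densities. -/
def IsFisherFlow {d N : ℕ} (V : EuclideanSpace ℝ (Fin d) → ℝ) (Vk : Fin d → ℝ → ℝ)
    (U : ℝ → Idx d N → ℝ) : Prop :=
  ∀ t, 0 ≤ t → U t ∈ PPos d N ∧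
    HasDerivWithinAt U (-onsager Vk (U t) (differential (fisherH V Vk) (U t))) (Set.Ici 0) t

/-- The discrete convexity modulus `λʰ = (2 / h²) (1 - exp (- h² λ / 2))`. -/
def lambdaH (lam h : ℝ) : ℝ := 2 / h ^ 2 * (1 - Real.exp (-(h ^ 2 / 2 * lam)))

end QDD

end

/-! Write `ρ = U / Π`, let `H` be the discrete entropy, `I` the discrete Fisher information, and `κ
= 2 λʰ`. The logarithmic mean in the Onsager operator cancels the logarithm in `DH`, so `-K DH` is
linear in `ρ`: it is `Π` times the generator, applied to `ρ`, of a reversible nearest-neighbour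
Markov chain with rates `exp ((v a - v b) / 2) / h²`. Consequently `I` is a sum over edges of a
conductance times `φ(ρ i, ρ j)`, where `φ(a, b) = (a - b) (log a - log b)` is convex.

The heart of the matter is the inequality `κ I ≤ DI[K DH]` (`fisher_le_onsagerForm`), i.e. decay of
`I` at rate `κ` along the discrete heat flow. It follows from a coupling argument. Put one particle
at each end of an edge and let the two jump together as far as their rates allow. By convexity of
`φ`, simultaneous jumps are controlled by differences of `φ` between edges, and these sum to zero by
reversibility. Convexity of the potential leaves an excess of the rates with which the particles
jump onto each other; these coalescing jumps produce the decay (`fisherDensity_coalescence`,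
`birthDeath_decay`). Separability makes the rates orthogonal to an edge equal at its two ends, so
that `d` dimensions reduce to one (`cross_decay`, `parallel_decay`). The cell averages of `V` have
second differences at least `h² λ`, whence the exponential in `λʰ`.

The rest is a soft argument (`decay_of_dissipation`). Along the flow, `H' = -b` and `I' = -c` with
`b = DI[K DH]` and `c = DI[K DI]`. Positivity of `K` at `DI - κ DH` gives `c - 2 κ b + κ² I ≥ 0`;
with `b ≥ κ I` this yields `c ≥ κ b ≥ κ² I`. Thus `I` decays at rate `κ²`, and `I - κ H` is
nonincreasing. Connectedness of the grid makes `H` vanish in the limit together with `I`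
(`tendsto_gridEntropy`), so `κ H ≤ I` along the solution; then `H` decays at rate `κ²` as well. The
regularisation bound comes from the monotone quantity `H + κ t I`, the `L¹` bound from the
Csiszár-Kullback-Pinsker inequality (`pinsker`). -/

namespace QDD

/-! ### The function `(a - b) (log a - log b)` -/

/-- The integrand `(a - b) (log a - log b)` of the discrete Fisher information. -/
noncomputable def fisherDensity (a b : ℝ) : ℝ := (a - b) * (Real.log a - Real.log b)

/-- The derivative of `fisherDensity` in its first argument. -/
noncomputable def fisherDensityDeriv (a b : ℝ) : ℝ := Real.log a - Real.log b + 1 - b / a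

theorem fisherDensity_comm (a b : ℝ) : fisherDensity a b = fisherDensity b a := by
  unfold fisherDensity; ring

theorem fisherDensity_nonneg {a b : ℝ} (ha : 0 < a) (hb : 0 < b) : 0 ≤ fisherDensity a b := by
  unfold fisherDensity
  rcases le_total a b with h | h
  · exact mul_nonneg_of_nonpos_of_nonpos (by linarith)
      (by linarith [Real.log_le_log ha h])
  · exact mul_nonneg (by linarith) (by linarith [Real.log_le_log hb h])

/-- Convexity of `fisherDensity`: the graph lies above its tangent planes. -/
theorem fisherDensity_tangent {a b a' b' : ℝ} (ha : 0 < a) (hb : 0 < b) (ha' : 0 < a')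
    (hb' : 0 < b') :
    fisherDensityDeriv a b * (a' - a) + fisherDensityDeriv b a * (b' - b) ≤
      fisherDensity a' b' - fisherDensity a b := by
  unfold fisherDensity fisherDensityDeriv
  set l := Real.log a' + Real.log b - Real.log a - Real.log b' with hl
  have hlog : Real.log (a' * b / (a * b')) = l := by
    rw [Real.log_div (by positivity) (by positivity), Real.log_mul ha'.ne' hb.ne',
      Real.log_mul ha.ne' hb'.ne']
    ring
  have h1 : l ≤ a' * b / (a * b') - 1 := by
    rw [← hlog]; exact Real.log_le_sub_one_of_pos (by positivity)
  have h2 : 1 - (a' * b / (a * b'))⁻¹ ≤ l := by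
    rw [← hlog]; exact Real.one_sub_inv_le_log_of_pos (by positivity)
  have h3 : b' * l ≤ a' * b / a - b' := by
    calc b' * l ≤ b' * (a' * b / (a * b') - 1) := by gcongr
      _ = _ := by field_simp
  have h4 : a' - a * b' / b ≤ a' * l := by
    calc a' - a * b' / b = a' * (1 - (a' * b / (a * b'))⁻¹) := by field_simp
      _ ≤ _ := by gcongr
  have e1 : b / a * (a' - a) = a' * b / a - b := by field_simp
  have e2 : a / b * (b' - b) = a * b' / b - a := by field_simp
  have e3 : a' * l - b' * l = (a' - b') * l := by ring
  rw [hl] at h3 h4 e3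
  nlinarith [h3, h4, e1, e2, e3]

/-- The logarithmic mean dominates the geometric mean. -/
theorem fisherDensity_mul_sq_le {s u : ℝ} (hs : 0 < s) (hu : 0 < u) :
    fisherDensity (s ^ 2) (u ^ 2) * (s * u) ≤ (s ^ 2 - u ^ 2) ^ 2 := by
  wlog h : u ≤ s generalizing s u
  · have := this hu hs (le_of_not_ge h)
    rw [fisherDensity_comm]
    nlinarith [this]
  have hx : 0 ≤ Real.log (s / u) := Real.log_nonneg ((one_le_div hu).2 h)
  -- This is `x ≤ sinh x` at `x = log (s / u) ≥ 0`.
  have h1 : Real.log (s / u) ≤ (s / u - (s / u)⁻¹) / 2 := by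
    rw [← Real.sinh_log (by positivity)]
    exact Real.self_le_sinh_iff.2 hx
  have h2 : (s / u - (s / u)⁻¹) * (s * u) = s ^ 2 - u ^ 2 := by field_simp
  have h3 : fisherDensity (s ^ 2) (u ^ 2) = (s ^ 2 - u ^ 2) * (2 * Real.log (s / u)) := by
    unfold fisherDensity
    rw [Real.log_div hs.ne' hu.ne', Real.log_pow, Real.log_pow]
    push_cast; ring
  have h4 : 0 ≤ s ^ 2 - u ^ 2 := by nlinarith
  calc fisherDensity (s ^ 2) (u ^ 2) * (s * u)
      = (s ^ 2 - u ^ 2) * (2 * Real.log (s / u) * (s * u)) := by rw [h3]; ring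
    _ ≤ (s ^ 2 - u ^ 2) * (2 * ((s / u - (s / u)⁻¹) / 2) * (s * u)) := by gcongr
    _ = (s ^ 2 - u ^ 2) ^ 2 := by
        rw [show 2 * ((s / u - (s / u)⁻¹) / 2) * (s * u) = (s / u - (s / u)⁻¹) * (s * u) by ring,
          h2]
        ring

theorem fisherDensityDeriv_mul_sub {a b : ℝ} (ha : 0 < a) :
    fisherDensityDeriv a b * (b - a) = -(fisherDensity a b + (a - b) ^ 2 / a) := by
  unfold fisherDensity fisherDensityDeriv
  field_simp
  ring

/-- The gain from an excess `p` of the jump rate of the first particle onto the second one, and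
an excess `m` of the jump rate of the second particle onto the first one. -/
theorem fisherDensity_coalescence {a b c t p m : ℝ} (ha : 0 < a) (hb : 0 < b) (hc : 0 ≤ c)
    (ht : 0 < t) (hp : c * t ≤ p) (hm : c / t ≤ m) :
    p * (fisherDensityDeriv a b * (b - a)) + m * (fisherDensityDeriv b a * (a - b)) ≤
      -(4 * c) * fisherDensity a b := by
  rw [fisherDensityDeriv_mul_sub ha, fisherDensityDeriv_mul_sub hb, fisherDensity_comm b a]
  have hφ := fisherDensity_nonneg ha hb
  set φ := fisherDensity a b with hφdef
  have h1 : c * t * (φ + (a - b) ^ 2 / a) ≤ p * (φ + (a - b) ^ 2 / a) := by gcongr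
  have h2 : c / t * (φ + (b - a) ^ 2 / b) ≤ m * (φ + (b - a) ^ 2 / b) := by gcongr
  -- The constant `4 c` consists of two halves: here `t + 1/t ≥ 2`; in `h4`, the weighted AM-GM
  -- inequality gives `2 (a - b)² / √(a b)`, which is at least `2 φ` because the logarithmic mean
  -- dominates the geometric one.
  have h3 : 2 * φ ≤ (t + 1 / t) * φ := by
    have : 2 ≤ t + 1 / t := by
      have : t + 1 / t - 2 = (t - 1) ^ 2 / t := by field_simp; ring
      have : 0 ≤ (t - 1) ^ 2 / t := by positivity
      linarith
    gcongr
  have h4 : 2 * φ ≤ t * ((a - b) ^ 2 / a) + 1 / t * ((b - a) ^ 2 / b) := by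
    obtain ⟨s, hs, rfl⟩ : ∃ s, 0 < s ∧ a = s ^ 2 :=
      ⟨√a, Real.sqrt_pos.2 ha, (Real.sq_sqrt ha.le).symm⟩
    obtain ⟨u, hu, rfl⟩ : ∃ s, 0 < s ∧ b = s ^ 2 :=
      ⟨√b, Real.sqrt_pos.2 hb, (Real.sq_sqrt hb.le).symm⟩
    have h5 := fisherDensity_mul_sq_le hs hu
    rw [← le_div_iff₀ (by positivity), ← hφdef] at h5
    have h6 : t * ((s ^ 2 - u ^ 2) ^ 2 / s ^ 2) + 1 / t * ((u ^ 2 - s ^ 2) ^ 2 / u ^ 2)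
        - 2 * ((s ^ 2 - u ^ 2) ^ 2 / (s * u)) =
        (s ^ 2 - u ^ 2) ^ 2 * (t * u - s) ^ 2 / (t * s ^ 2 * u ^ 2) := by
      field_simp; ring
    have h7 : 0 ≤ (s ^ 2 - u ^ 2) ^ 2 * (t * u - s) ^ 2 / (t * s ^ 2 * u ^ 2) := by positivity
    linarith
  have h5 : c * (4 * φ) ≤ c * ((t + 1 / t) * φ +
      (t * ((a - b) ^ 2 / a) + 1 / t * ((b - a) ^ 2 / b))) := by
    gcongr; linarith
  have h6 : c * ((t + 1 / t) * φ + (t * ((a - b) ^ 2 / a) + 1 / t * ((b - a) ^ 2 / b))) =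
      c * t * (φ + (a - b) ^ 2 / a) + c / t * (φ + (b - a) ^ 2 / b) := by
    field_simp
    ring
  linarith

/-! ### Birth-death chains -/

/-- Coupling of two particles at neighbouring sites with values `a` and `b`. They jump together to
the right at rate `α'` and to the left at rate `β`; convexity bounds these contributions by
differences of `fisherDensity`. The remaining rates `α - α'` and `β' - β` move one particle onto the
other. -/
theorem birthDeath_edge_le {z a b y c t α α' β β' : ℝ} (hz : 0 < z) (ha : 0 < a) (hb : 0 < b)
    (hy : 0 < y) (hc : 0 ≤ c) (ht : 0 < t) (hα' : 0 ≤ α') (hβ : 0 ≤ β)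
    (hp : c * t ≤ α - α') (hm : c / t ≤ β' - β) :
    fisherDensityDeriv a b * (α * (b - a) + β * (z - a)) +
        fisherDensityDeriv b a * (α' * (y - b) + β' * (a - b)) ≤
      α' * (fisherDensity b y - fisherDensity a b) +
        β * (fisherDensity z a - fisherDensity a b) - 4 * c * fisherDensity a b := by
  have h1 := mul_le_mul_of_nonneg_left (fisherDensity_tangent ha hb hb hy) hα'
  have h2 := mul_le_mul_of_nonneg_left (fisherDensity_tangent ha hb hz ha) hβ
  have h3 := fisherDensity_coalescence ha hb hc ht hp hm
  linarith

/-- Exponential decay of the Fisher information along the heat flow of a birth-death chain with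
birth rates `α`, death rates `β` and equilibrium edge flux `κ`, in differential form. -/
theorem birthDeath_decay (M : ℕ) (κ α β r t : ℕ → ℝ) (c : ℝ) (hc : 0 ≤ c)
    (hκ : ∀ j < M, 0 ≤ κ j) (hα : ∀ j, 0 ≤ α j) (hβ : ∀ j, 0 ≤ β j)
    (hαM : α M = 0) (hβ0 : β 0 = 0)
    (hbal : ∀ j, j + 1 < M → κ j * α (j + 1) = κ (j + 1) * β (j + 1))
    (hr : ∀ j, 0 < r j) (ht : ∀ j, 0 < t j)
    (hα' : ∀ j < M, c * t j ≤ α j - α (j + 1)) (hβ' : ∀ j < M, c / t j ≤ β (j + 1) - β j) :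
    ∑ j ∈ Finset.range M, κ j *
      (fisherDensityDeriv (r j) (r (j + 1)) *
          (α j * (r (j + 1) - r j) + β j * (r (j - 1) - r j)) +
        fisherDensityDeriv (r (j + 1)) (r j) *
          (α (j + 1) * (r (j + 2) - r (j + 1)) + β (j + 1) * (r j - r (j + 1)))) ≤
      -(4 * c) * ∑ j ∈ Finset.range M, κ j * fisherDensity (r j) (r (j + 1)) := by
  -- The chain of edges, with rates `α (j + 1)` to the right and `β j` to the left, is reversible
  -- with respect to `κ`. Hence the terms from simultaneous jumps are increments of the edge current
  -- `x`, which vanishes at both ends, and they telescope to zero.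
  set x : ℕ → ℝ := fun j => if j < M then
    κ j * β j * (fisherDensity (r j) (r (j + 1)) - fisherDensity (r (j - 1)) (r j)) else 0 with hx
  have hx1 : ∀ j < M, x (j + 1) = κ j * α (j + 1) *
      (fisherDensity (r (j + 1)) (r (j + 2)) - fisherDensity (r j) (r (j + 1))) := by
    intro j hj
    by_cases h : j + 1 < M
    · simp only [hx, if_pos h, Nat.add_sub_cancel, hbal j h]
    · have : M = j + 1 := by omega
      simp only [hx, if_neg h]
      rw [← this, hαM]; ring
  have hx0 : x 0 = 0 := by simp [hx, hβ0]
  have hxM : x M = 0 := by simp [hx]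
  have key : ∀ j ∈ Finset.range M, κ j *
      (fisherDensityDeriv (r j) (r (j + 1)) *
          (α j * (r (j + 1) - r j) + β j * (r (j - 1) - r j)) +
        fisherDensityDeriv (r (j + 1)) (r j) *
          (α (j + 1) * (r (j + 2) - r (j + 1)) + β (j + 1) * (r j - r (j + 1)))) ≤
      (x (j + 1) - x j) + -(4 * c) * (κ j * fisherDensity (r j) (r (j + 1))) := by
    intro j hj
    rw [Finset.mem_range] at hj
    have h1 := mul_le_mul_of_nonneg_left (birthDeath_edge_le (hr (j - 1)) (hr j) (hr (j + 1))
      (hr (j + 2)) hc (ht j) (hα (j + 1)) (hβ j) (hα' j hj) (hβ' j hj)) (hκ j hj)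
    refine h1.trans (le_of_eq ?_)
    rw [hx1 j hj]
    simp only [hx, if_pos hj]
    ring
  refine (Finset.sum_le_sum key).trans (le_of_eq ?_)
  rw [Finset.sum_add_distrib, Finset.sum_range_sub, hx0, hxM, ← Finset.mul_sum]
  ring

/-! ### Finite sums over neighbours -/

/-- Two cells of a row are neighbours. -/
def Adj {N : ℕ} (a b : Fin N) : Prop := (a : ℕ) + 1 = b ∨ (b : ℕ) + 1 = a

instance {N : ℕ} (a b : Fin N) : Decidable (Adj a b) := by unfold Adj; infer_instance

theorem Adj.symm {N : ℕ} {a b : Fin N} (h : Adj a b) : Adj b a := Or.symm h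

theorem sum_fin_ite_succ_eq (N a : ℕ) (f : ℕ → ℝ) :
    (∑ b : Fin N, if a + 1 = (b : ℕ) then f b else 0) = if a + 1 < N then f (a + 1) else 0 := by
  rw [Fin.sum_univ_eq_sum_range (fun b => if a + 1 = b then f b else 0) N]
  simp [Finset.sum_ite_eq]

theorem sum_fin_ite_eq_succ (N a : ℕ) (ha : a < N) (f : ℕ → ℝ) :
    (∑ b : Fin N, if (b : ℕ) + 1 = a then f b else 0) = if 0 < a then f (a - 1) else 0 := by
  rw [Fin.sum_univ_eq_sum_range (fun b => if b + 1 = a then f b else 0) N]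
  rcases a with _ | a
  · simp
  · simp only [add_left_inj, Finset.sum_ite_eq', Finset.mem_range]
    rw [if_pos (by omega)]
    simp

theorem sum_adj_eq {N : ℕ} (a : Fin N) (f : ℕ → ℝ) :
    (∑ b : Fin N, if Adj a b then f b else 0) =
      (if (a : ℕ) + 1 < N then f (a + 1) else 0) + (if 0 < (a : ℕ) then f (a - 1) else 0) := by
  rw [← sum_fin_ite_succ_eq, ← sum_fin_ite_eq_succ N a a.2, ← Finset.sum_add_distrib]
  refine Finset.sum_congr rfl fun b _ => ?_
  unfold Adj
  by_cases h1 : (a : ℕ) + 1 = b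
  · have h2 : ¬ (b : ℕ) + 1 = a := by omega
    simp [h1, h2]
  · simp [h1]

theorem sum_sum_adj_eq (N : ℕ) (F : ℕ → ℕ → ℝ) :
    (∑ a : Fin N, ∑ b : Fin N, if Adj a b then F a b else 0) =
      ∑ j ∈ Finset.range (N - 1), (F j (j + 1) + F (j + 1) j) := by
  simp only [fun a : Fin N => sum_adj_eq a (F a)]
  rw [Fin.sum_univ_eq_sum_range (fun a => (if a + 1 < N then F a (a + 1) else 0) +
    (if 0 < a then F a (a - 1) else 0)) N]
  rcases N with _ | M
  · simp
  · rw [Finset.sum_add_distrib, Finset.sum_range_succ, Finset.sum_range_succ', Nat.add_sub_cancel,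
      Finset.sum_add_distrib]
    simp only [lt_irrefl, if_false, add_zero, Nat.succ_pos, if_true, Nat.add_sub_cancel]
    congr 1
    refine Finset.sum_congr rfl fun j hj => ?_
    rw [Finset.mem_range] at hj
    rw [if_pos (by omega)]

/-! ### Decay of the Fisher information on a single row -/

/-- The jump rates of the one-dimensional chain with potential `v`. -/
noncomputable def jumpRate {N : ℕ} (v : Fin N → ℝ) (a b : Fin N) : ℝ :=
  if Adj a b then Real.exp ((v a - v b) / 2) / mesh N ^ 2 else 0

/-- The generator of the one-dimensional chain with potential `v`. -/
noncomputable def rowGenerator {N : ℕ} (v r : Fin N → ℝ) (a : Fin N) : ℝ :=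
  ∑ b, jumpRate v a b * (r b - r a)

theorem mesh_pos {N : ℕ} (hN : 1 ≤ N) : 0 < mesh N := by
  have : (0 : ℝ) < N := by exact_mod_cast hN
  unfold mesh; positivity

theorem jumpRate_nonneg {N : ℕ} (v : Fin N → ℝ) (a b : Fin N) : 0 ≤ jumpRate v a b := by
  unfold jumpRate; split_ifs <;> positivity

/-- Decay of the Fisher information along the heat flow of a one-dimensional chain. -/
theorem row_decay {N : ℕ} (hN : 1 ≤ N) (v w r : Fin N → ℝ) {μ : ℝ} (hμ : 0 ≤ μ)
    (hv : ∀ a b c : Fin N, (a : ℕ) + 1 = b → (b : ℕ) + 1 = c → μ ≤ v a + v c - 2 * v b)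
    (hw : ∀ a, 0 < w a) (hr : ∀ a, 0 < r a)
    (hbal : ∀ a b, w a * jumpRate v a b = w b * jumpRate v b a) :
    ∑ a, ∑ b, w a * jumpRate v a b * (fisherDensityDeriv (r a) (r b) * rowGenerator v r a +
        fisherDensityDeriv (r b) (r a) * rowGenerator v r b) ≤
      -(4 * ((1 - Real.exp (-μ / 2)) / mesh N ^ 2)) *
        ∑ a, ∑ b, w a * jumpRate v a b * fisherDensity (r a) (r b) := by
  have hh := mesh_pos hN
  set h := mesh N with hhdef
  set q := Real.exp (-μ / 2) with hq
  have hq0 : 0 < q := Real.exp_pos _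
  have hq1 : q ≤ 1 := Real.exp_le_one_iff.2 (by linarith)
  -- Extension by clamping the index: positivity persists on all of `ℕ`, and the values beyond `N -
  -- 1` only ever meet vanishing rates.
  let ext : (Fin N → ℝ) → ℕ → ℝ := fun f n => f ⟨min n (N - 1), by omega⟩
  have hext : ∀ (f : Fin N → ℝ) (a : Fin N), ext f a = f a := by
    intro f a
    simp only [ext]
    congr 1
    apply Fin.ext
    simp only
    omega
  have hext' : ∀ (f : Fin N → ℝ) (n : ℕ) (hn : n < N), ext f n = f ⟨n, hn⟩ := fun f n hn =>
    hext f ⟨n, hn⟩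
  let V := ext v
  let W := ext w
  let R := ext r
  have hR : ∀ j, 0 < R j := fun j => hr _
  have hW : ∀ j, 0 < W j := fun j => hw _
  let e : ℕ → ℕ → ℝ := fun n m => Real.exp ((V n - V m) / 2) / h ^ 2
  have he : ∀ n m, 0 < e n m := fun n m => by positivity
  have hconv : ∀ j, j + 2 < N → μ ≤ V j + V (j + 2) - 2 * V (j + 1) := by
    intro j hj
    have := hv ⟨j, by omega⟩ ⟨j + 1, by omega⟩ ⟨j + 2, hj⟩ rfl rfl
    simpa only [V, hext' v j (by omega), hext' v (j + 1) (by omega), hext' v (j + 2) hj] using this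
  have hsym : ∀ j, j + 1 < N → W j * e j (j + 1) = W (j + 1) * e (j + 1) j := by
    intro j hj
    have := hbal ⟨j, by omega⟩ ⟨j + 1, hj⟩
    simp only [jumpRate, Adj] at this
    simpa only [W, e, V, hext' _ j (show j < N by omega), hext' _ (j + 1) hj, true_or, or_true,
      if_true] using this
  let α : ℕ → ℝ := fun j => if j + 1 < N then e j (j + 1) else 0
  let β : ℕ → ℝ := fun j => if 0 < j then e j (j - 1) else 0
  let L : ℕ → ℝ := fun n => α n * (R (n + 1) - R n) + β n * (R (n - 1) - R n)
  have hL : ∀ a : Fin N, rowGenerator v r a = L a := by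
    intro a
    have : rowGenerator v r a = ∑ b : Fin N, if Adj a b then
        (fun m => e a m * (R m - R a)) (b : ℕ) else 0 := by
      refine Finset.sum_congr rfl fun b _ => ?_
      simp only [jumpRate, e, V, R, hext, ite_mul, zero_mul]
      rfl
    rw [this, sum_adj_eq a (fun m => e a m * (R m - R a))]
    simp only [L, α, β, ite_mul, zero_mul]
  -- The factor `2` arises since every edge occurs in both orientations, with equal weight by
  -- detailed balance.
  have hF : ∀ G : ℕ → ℕ → ℝ, (∀ n m, G n m = G m n) →
      ∑ a : Fin N, ∑ b : Fin N, w a * jumpRate v a b * G a b =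
        2 * ∑ j ∈ Finset.range (N - 1), W j * e j (j + 1) * G j (j + 1) := by
    intro G hG
    have : ∑ a : Fin N, ∑ b : Fin N, w a * jumpRate v a b * G a b =
        ∑ a : Fin N, ∑ b : Fin N, if Adj a b then
          (fun n m => W n * e n m * G n m) (a : ℕ) (b : ℕ) else 0 := by
      refine Finset.sum_congr rfl fun a _ => Finset.sum_congr rfl fun b _ => ?_
      simp only [jumpRate, e, V, W, hext, mul_ite, mul_zero, ite_mul, zero_mul]
      rfl
    rw [this, sum_sum_adj_eq N (fun n m => W n * e n m * G n m), Finset.mul_sum]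
    refine Finset.sum_congr rfl fun j hj => ?_
    rw [Finset.mem_range] at hj
    simp only [← hsym j (by omega), hG (j + 1) j]
    ring
  have h1 : ∑ a, ∑ b, w a * jumpRate v a b * (fisherDensityDeriv (r a) (r b) * rowGenerator v r a +
        fisherDensityDeriv (r b) (r a) * rowGenerator v r b) =
      2 * ∑ j ∈ Finset.range (N - 1), W j * e j (j + 1) *
        (fisherDensityDeriv (R j) (R (j + 1)) * L j +
          fisherDensityDeriv (R (j + 1)) (R j) * L (j + 1)) := by
    rw [← hF (fun n m => fisherDensityDeriv (R n) (R m) * L n + fisherDensityDeriv (R m) (R n) * L m)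
      (fun n m => add_comm _ _)]
    refine Finset.sum_congr rfl fun a _ => Finset.sum_congr rfl fun b _ => ?_
    simp only [hL, R, hext]
  have h2 : ∑ a, ∑ b, w a * jumpRate v a b * fisherDensity (r a) (r b) =
      2 * ∑ j ∈ Finset.range (N - 1), W j * e j (j + 1) * fisherDensity (R j) (R (j + 1)) := by
    rw [← hF (fun n m => fisherDensity (R n) (R m)) (fun n m => fisherDensity_comm _ _)]
    refine Finset.sum_congr rfl fun a _ => Finset.sum_congr rfl fun b _ => ?_
    simp only [R, hext]
  -- A row of `N` cells has `N - 1` edges. With `t j = exp ((V j - V (j + 1)) / 2)`, the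
  -- second-difference bound `μ` makes `α (j + 1) ≤ q α j` and `β j ≤ q β (j + 1)`, where `q = exp
  -- (-μ / 2)`. The rate excesses are therefore at least `c t j` and `c / t j` with `c = (1 - q) /
  -- h²`.
  have h3 := birthDeath_decay (N - 1) (fun j => W j * e j (j + 1)) α β R
    (fun j => Real.exp ((V j - V (j + 1)) / 2)) ((1 - q) / h ^ 2)
    (div_nonneg (by linarith) (by positivity)) (fun j _ => (mul_pos (hW j) (he _ _)).le)
    (fun j => by simp only [α]; split_ifs <;> first | exact (he _ _).le | exact le_rfl)
    (fun j => by simp only [β]; split_ifs <;> first | exact (he _ _).le | exact le_rfl)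
    (by simp only [α]; rw [if_neg (by omega)]) (by simp [β])
    (fun j hj => by
      simp only [α, β]
      rw [if_pos (by omega), if_pos (by omega), hsym j (by omega), Nat.add_sub_cancel]
      ring)
    hR (fun j => Real.exp_pos _)
    (fun j hj => by
      have hb : α (j + 1) ≤ q * Real.exp ((V j - V (j + 1)) / 2) / h ^ 2 := by
        simp only [α]
        split_ifs with h'
        · simp only [e]
          rw [hq, ← Real.exp_add]
          gcongr
          have := hconv j h'
          rw [show j + 1 + 1 = j + 2 from rfl]
          linarith
        · positivity
      have ha : α j = Real.exp ((V j - V (j + 1)) / 2) / h ^ 2 := by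
        simp only [α]; rw [if_pos (by omega)]
      rw [ha]
      refine le_sub_comm.1 (hb.trans (le_of_eq ?_))
      ring)
    (fun j hj => by
      have hb : β j ≤ q * Real.exp ((V (j + 1) - V j) / 2) / h ^ 2 := by
        simp only [β]
        split_ifs with h'
        · obtain ⟨i, rfl⟩ : ∃ i, j = i + 1 := ⟨j - 1, by omega⟩
          simp only [e, Nat.add_sub_cancel]
          rw [hq, ← Real.exp_add]
          gcongr
          have := hconv i (by omega)
          rw [show i + 1 + 1 = i + 2 from rfl]
          linarith
        · positivity
      have ha : β (j + 1) = Real.exp ((V (j + 1) - V j) / 2) / h ^ 2 := by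
        simp only [β]; rw [if_pos (by omega)]; simp [e]
      have hi : (1 - q) / h ^ 2 / Real.exp ((V j - V (j + 1)) / 2) =
          (1 - q) * Real.exp ((V (j + 1) - V j) / 2) / h ^ 2 := by
        rw [show (V (j + 1) - V j) / 2 = -((V j - V (j + 1)) / 2) by ring, Real.exp_neg]
        field_simp
      rw [ha, hi]
      refine le_sub_comm.1 (hb.trans (le_of_eq ?_))
      ring)
  rw [h1, h2]
  calc _ ≤ 2 * (-(4 * ((1 - q) / h ^ 2)) * ∑ j ∈ Finset.range (N - 1),
        W j * e j (j + 1) * fisherDensity (R j) (R (j + 1))) := by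
        gcongr
        exact h3
    _ = _ := by ring

/-! ### From rows to the `d`-dimensional grid -/

-- Exchanging the `k`-th coordinate of `i` with `c` is an involution of the pairs `(i, c)`. It
-- serves to reverse jumps and to average over rows.
open Function in
theorem sum_update_swap {d N : ℕ} (k : Fin d) (F : Idx d N → Fin N → ℝ) :
    ∑ i, ∑ c, F i c = ∑ i, ∑ c, F (update i k c) (i k) := by
  rw [← Fintype.sum_prod_type', ← Fintype.sum_prod_type' (fun i c => F (update i k c) (i k))]
  let T : Idx d N × Fin N → Idx d N × Fin N := fun p => (update p.1 k p.2, p.1 k)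
  have hT : Involutive T := by
    rintro ⟨i, c⟩
    simp [T]
  exact (Equiv.sum_comp hT.toPerm (fun p : Idx d N × Fin N => F p.1 p.2)).symm

/-- The part in direction `m` of the generator of the chain on the grid. -/
noncomputable def dirGenerator {d N : ℕ} (v : Fin d → Fin N → ℝ) (m : Fin d) (ρ : Idx d N → ℝ)
    (i : Idx d N) : ℝ :=
  ∑ c, jumpRate (v m) (i m) c * (ρ (Function.update i m c) - ρ i)

open Function in
/-- Jumps in a direction orthogonal to an edge do not increase the Fisher information. -/
theorem cross_decay {d N : ℕ} (v : Fin d → Fin N → ℝ) {P ρ : Idx d N → ℝ} (hP : ∀ i, 0 < P i)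
    (hρ : ∀ i, 0 < ρ i)
    (hbal : ∀ i k b, P i * jumpRate (v k) (i k) b = P (update i k b) * jumpRate (v k) b (i k))
    {k m : Fin d} (hkm : m ≠ k) :
    ∑ i, ∑ b, P i * jumpRate (v k) (i k) b *
      (fisherDensityDeriv (ρ i) (ρ (update i k b)) * dirGenerator v m ρ i +
        fisherDensityDeriv (ρ (update i k b)) (ρ i) * dirGenerator v m ρ (update i k b)) ≤ 0 := by
  have hle : ∀ i b, P i * jumpRate (v k) (i k) b *
      (fisherDensityDeriv (ρ i) (ρ (update i k b)) * dirGenerator v m ρ i +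
        fisherDensityDeriv (ρ (update i k b)) (ρ i) * dirGenerator v m ρ (update i k b)) ≤
      ∑ c, P i * jumpRate (v k) (i k) b * jumpRate (v m) (i m) c *
        (fisherDensity (ρ (update i m c)) (ρ (update (update i m c) k b)) -
          fisherDensity (ρ i) (ρ (update i k b))) := by
    intro i b
    have e1 : fisherDensityDeriv (ρ i) (ρ (update i k b)) * dirGenerator v m ρ i +
        fisherDensityDeriv (ρ (update i k b)) (ρ i) * dirGenerator v m ρ (update i k b) =
        ∑ c, jumpRate (v m) (i m) c *
          (fisherDensityDeriv (ρ i) (ρ (update i k b)) * (ρ (update i m c) - ρ i) +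
            fisherDensityDeriv (ρ (update i k b)) (ρ i) *
              (ρ (update (update i m c) k b) - ρ (update i k b))) := by
      unfold dirGenerator
      rw [Finset.mul_sum, Finset.mul_sum, ← Finset.sum_add_distrib]
      refine Finset.sum_congr rfl fun c _ => ?_
      -- The jump rates in direction `m` depend on the `m`-th coordinate only, so they agree at the
      -- two ends of an edge in direction `k`, and both ends can jump simultaneously.
      rw [update_of_ne hkm, update_comm hkm.symm]
      ring
    rw [e1, Finset.mul_sum]
    refine Finset.sum_le_sum fun c _ => ?_
    rw [← mul_assoc]
    exact mul_le_mul_of_nonneg_left (fisherDensity_tangent (hρ _) (hρ _) (hρ _) (hρ _))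
      (mul_nonneg (mul_nonneg (hP i).le (jumpRate_nonneg _ _ _)) (jumpRate_nonneg _ _ _))
  refine (Finset.sum_le_sum fun i _ => Finset.sum_le_sum fun b _ => hle i b).trans (le_of_eq ?_)
  have hzero : ∀ b, ∑ i, ∑ c, P i * jumpRate (v k) (i k) b * jumpRate (v m) (i m) c *
        (fisherDensity (ρ (update i m c)) (ρ (update (update i m c) k b)) -
          fisherDensity (ρ i) (ρ (update i k b))) = 0 := by
    intro b
    have h := sum_update_swap m (fun i c => P i * jumpRate (v k) (i k) b * jumpRate (v m) (i m) c *
        (fisherDensity (ρ (update i m c)) (ρ (update (update i m c) k b)) -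
          fisherDensity (ρ i) (ρ (update i k b))))
    -- Reversing the jump in direction `m` flips the sign of the difference, while detailed balance
    -- preserves the weight; the sum equals its own negative.
    have h' : ∑ i, ∑ c, P (update i m c) * jumpRate (v k) (update i m c k) b *
          jumpRate (v m) (update i m c m) (i m) *
        (fisherDensity (ρ (update (update i m c) m (i m)))
            (ρ (update (update (update i m c) m (i m)) k b)) -
          fisherDensity (ρ (update i m c)) (ρ (update (update i m c) k b))) =
        -∑ i, ∑ c, P i * jumpRate (v k) (i k) b * jumpRate (v m) (i m) c *
        (fisherDensity (ρ (update i m c)) (ρ (update (update i m c) k b)) -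
          fisherDensity (ρ i) (ρ (update i k b))) := by
      rw [← Finset.sum_neg_distrib]
      refine Finset.sum_congr rfl fun i _ => ?_
      rw [← Finset.sum_neg_distrib]
      refine Finset.sum_congr rfl fun c _ => ?_
      rw [update_of_ne hkm.symm, update_self, update_idem, update_eq_self]
      linear_combination (jumpRate (v k) (i k) b * (fisherDensity (ρ (update i m c))
        (ρ (update (update i m c) k b)) - fisherDensity (ρ i) (ρ (update i k b)))) * hbal i m c
    rw [h'] at h
    linarith
  calc _ = ∑ i, ∑ b, ∑ c, P i * jumpRate (v k) (i k) b * jumpRate (v m) (i m) c *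
        (fisherDensity (ρ (update i m c)) (ρ (update (update i m c) k b)) -
          fisherDensity (ρ i) (ρ (update i k b))) := rfl
    _ = 0 := by
      rw [Finset.sum_comm]
      exact Finset.sum_eq_zero fun b _ => hzero b

open Function in
/-- Jumps along the direction of an edge let the Fisher information decay. -/
theorem parallel_decay {d N : ℕ} (hN : 1 ≤ N) (v : Fin d → Fin N → ℝ) {P ρ : Idx d N → ℝ}
    (hP : ∀ i, 0 < P i) (hρ : ∀ i, 0 < ρ i)
    (hbal : ∀ i k b, P i * jumpRate (v k) (i k) b = P (update i k b) * jumpRate (v k) b (i k))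
    {μ : ℝ} (hμ : 0 ≤ μ) (k : Fin d)
    (hv : ∀ a b c : Fin N, (a : ℕ) + 1 = b → (b : ℕ) + 1 = c → μ ≤ v k a + v k c - 2 * v k b) :
    ∑ i, ∑ b, P i * jumpRate (v k) (i k) b *
      (fisherDensityDeriv (ρ i) (ρ (update i k b)) * dirGenerator v k ρ i +
        fisherDensityDeriv (ρ (update i k b)) (ρ i) * dirGenerator v k ρ (update i k b)) ≤
      -(4 * ((1 - Real.exp (-μ / 2)) / mesh N ^ 2)) *
        ∑ i, ∑ b, P i * jumpRate (v k) (i k) b * fisherDensity (ρ i) (ρ (update i k b)) := by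
  have hN' : (0 : ℝ) < N := by exact_mod_cast hN
  -- Summing over the row through each `i` counts every cell `N` times, so the claim splits into one
  -- inequality per row.
  have hrow : ∀ F : Idx d N → ℝ, N * ∑ i, F i = ∑ i, ∑ a, F (update i k a) := by
    intro F
    rw [← sum_update_swap k (fun i _ => F i)]
    simp [Finset.mul_sum]
  refine le_of_mul_le_mul_left ?_ hN'
  rw [mul_left_comm, hrow, hrow, Finset.mul_sum]
  refine Finset.sum_le_sum fun i _ => ?_
  have h := row_decay hN (v k) (fun a => P (update i k a)) (fun a => ρ (update i k a)) hμ hv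
    (fun _ => hP _) (fun _ => hρ _)
    (fun a b => by simpa using hbal (update i k a) k b)
  have hgen : ∀ a, dirGenerator v k ρ (update i k a) =
      rowGenerator (v k) (fun a => ρ (update i k a)) a := by
    intro a
    simp [dirGenerator, rowGenerator]
  simpa only [update_idem, update_self, hgen] using h

/-- The generator of the chain on the grid. -/
noncomputable def gridGenerator {d N : ℕ} (v : Fin d → Fin N → ℝ) (ρ : Idx d N → ℝ)
    (i : Idx d N) : ℝ :=
  ∑ m, dirGenerator v m ρ i

open Function in
/-- Decay of the Fisher information along the heat flow on the grid, in differential form. -/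
theorem grid_decay {d N : ℕ} (hN : 1 ≤ N) (v : Fin d → Fin N → ℝ) {P ρ : Idx d N → ℝ}
    (hP : ∀ i, 0 < P i) (hρ : ∀ i, 0 < ρ i)
    (hbal : ∀ i k b, P i * jumpRate (v k) (i k) b = P (update i k b) * jumpRate (v k) b (i k))
    {μ : ℝ} (hμ : 0 ≤ μ)
    (hv : ∀ k, ∀ a b c : Fin N, (a : ℕ) + 1 = b → (b : ℕ) + 1 = c →
      μ ≤ v k a + v k c - 2 * v k b) :
    ∑ i, ∑ k, ∑ b, P i * jumpRate (v k) (i k) b *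
      (fisherDensityDeriv (ρ i) (ρ (update i k b)) * gridGenerator v ρ i +
        fisherDensityDeriv (ρ (update i k b)) (ρ i) * gridGenerator v ρ (update i k b)) ≤
      -(4 * ((1 - Real.exp (-μ / 2)) / mesh N ^ 2)) *
        ∑ i, ∑ k, ∑ b, P i * jumpRate (v k) (i k) b * fisherDensity (ρ i) (ρ (update i k b)) := by
  rw [Finset.sum_comm, Finset.sum_comm (f := fun i k => ∑ b, P i * jumpRate (v k) (i k) b *
    fisherDensity (ρ i) (ρ (update i k b))), Finset.mul_sum]
  refine Finset.sum_le_sum fun k _ => ?_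
  have e : ∀ i b, P i * jumpRate (v k) (i k) b *
      (fisherDensityDeriv (ρ i) (ρ (update i k b)) * gridGenerator v ρ i +
        fisherDensityDeriv (ρ (update i k b)) (ρ i) * gridGenerator v ρ (update i k b)) =
      ∑ m, P i * jumpRate (v k) (i k) b *
      (fisherDensityDeriv (ρ i) (ρ (update i k b)) * dirGenerator v m ρ i +
        fisherDensityDeriv (ρ (update i k b)) (ρ i) * dirGenerator v m ρ (update i k b)) := by
    intro i b
    unfold gridGenerator
    rw [← Finset.mul_sum, Finset.sum_add_distrib, Finset.mul_sum, Finset.mul_sum]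
  simp only [e]
  rw [Finset.sum_congr rfl fun i _ => Finset.sum_comm, Finset.sum_comm]
  rw [← Finset.add_sum_erase _ _ (Finset.mem_univ k)]
  have h1 := parallel_decay hN v hP hρ hbal hμ k (hv k)
  have h2 : ∑ m ∈ Finset.univ.erase k, ∑ i, ∑ b, P i * jumpRate (v k) (i k) b *
      (fisherDensityDeriv (ρ i) (ρ (update i k b)) * dirGenerator v m ρ i +
        fisherDensityDeriv (ρ (update i k b)) (ρ i) * dirGenerator v m ρ (update i k b)) ≤ 0 :=
    Finset.sum_nonpos fun m hm => cross_decay v hP hρ hbal (Finset.ne_of_mem_erase hm)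
  linarith

/-! ### Neighbours in the grid -/

open Function in
theorem nbh_update {d N : ℕ} (i : Idx d N) (k : Fin d) {b : Fin N} (h : Adj (i k) b) :
    Nbh i (update i k b) := by
  unfold Nbh
  rw [Finset.sum_eq_single k]
  · rw [update_self]
    rcases h with h | h
    · rw [← h]; push_cast; ring
    · rw [← h]; push_cast; ring
  · intro m _ hm
    rw [update_of_ne hm]; ring
  · simp

open Function in
theorem exists_update_of_nbh {d N : ℕ} {i j : Idx d N} (h : Nbh i j) :
    ∃ k, Adj (i k) (j k) ∧ update i k (j k) = j := by
  unfold Nbh at h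
  obtain ⟨k, hk⟩ : ∃ k, i k ≠ j k := by
    by_contra! hc
    simp [hc] at h
  rw [← Finset.add_sum_erase _ _ (Finset.mem_univ k)] at h
  have hk' : (((i k : ℕ) : ℤ) - ((j k : ℕ) : ℤ)) ≠ 0 := by
    intro h0
    exact hk (Fin.ext (by omega))
  have hpos : 1 ≤ (((i k : ℕ) : ℤ) - ((j k : ℕ) : ℤ)) ^ 2 := by
    have : 0 < (((i k : ℕ) : ℤ) - ((j k : ℕ) : ℤ)) ^ 2 := by positivity
    omega
  have hnn : ∀ m ∈ Finset.univ.erase k, 0 ≤ (((i m : ℕ) : ℤ) - ((j m : ℕ) : ℤ)) ^ 2 :=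
    fun m _ => sq_nonneg _
  have hz : ∑ m ∈ Finset.univ.erase k, (((i m : ℕ) : ℤ) - ((j m : ℕ) : ℤ)) ^ 2 = 0 := by
    have := Finset.sum_nonneg hnn
    omega
  have hz' := (Finset.sum_eq_zero_iff_of_nonneg hnn).1 hz
  refine ⟨k, ?_, ?_⟩
  · rw [hz, add_zero] at h
    have := sq_eq_sq_iff_eq_or_eq_neg.1 (h.trans (one_pow 2).symm)
    unfold Adj
    omega
  · funext m
    by_cases hm : m = k
    · subst hm; simp
    · rw [update_of_ne hm]
      have := hz' m (Finset.mem_erase.2 ⟨hm, Finset.mem_univ _⟩)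
      exact Fin.ext (by have := pow_eq_zero_iff (two_ne_zero) |>.1 this; omega)

-- Being at distance one means differing by one in exactly one coordinate; this turns sums over grid
-- edges into sums over directions and one-dimensional jumps.
open Function in
theorem sum_nbh {d N : ℕ} (i : Idx d N) (F : Idx d N → ℝ) :
    (∑ j, if Nbh i j then F j else 0) =
      ∑ k, ∑ b, if Adj (i k) b then F (update i k b) else 0 := by
  rw [← Fintype.sum_prod_type' (fun k b => if Adj (i k) b then F (update i k b) else 0),
    ← Finset.sum_filter, ← Finset.sum_filter]
  symm
  refine Finset.sum_bij (fun p _ => update i p.1 p.2) ?_ ?_ ?_ ?_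
  · rintro ⟨k, b⟩ h
    simp only [Finset.mem_filter, Finset.mem_univ, true_and] at h ⊢
    exact nbh_update i k h
  · rintro ⟨k, b⟩ h ⟨k', b'⟩ h' heq
    simp only [Finset.mem_filter, Finset.mem_univ, true_and] at h h' heq
    have hne : ∀ {a b : Fin N}, Adj a b → a ≠ b := by
      rintro a b (h | h) rfl <;> omega
    have hkk : k = k' := by
      by_contra hc
      have := congrFun heq k
      rw [update_self, update_of_ne hc] at this
      exact hne h this.symm
    subst hkk
    have := congrFun heq k
    simp only [update_self] at this
    rw [this]
  · intro j hj
    simp only [Finset.mem_filter, Finset.mem_univ, true_and] at hj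
    obtain ⟨k, hk, hj'⟩ := exists_update_of_nbh hj
    exact ⟨(k, j k), by simpa using hk, hj'⟩
  · intros; rfl

/-! ### The discrete steady state -/

theorem discreteZ_pos {N : ℕ} (hN : 1 ≤ N) (v : ℝ → ℝ) : 0 < discreteZ N v := by
  have : Nonempty (Fin N) := ⟨⟨0, hN⟩⟩
  exact mul_pos (mesh_pos hN) (Finset.sum_pos (fun _ _ => Real.exp_pos _) Finset.univ_nonempty)

theorem discretePi_pos {d N : ℕ} (hN : 1 ≤ N) (Vk : Fin d → ℝ → ℝ) (i : Idx d N) :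
    0 < discretePi N Vk i :=
  Finset.prod_pos fun _ _ => div_pos (Real.exp_pos _) (discreteZ_pos hN _)

theorem mesh_pow_mul_card {d N : ℕ} (hN : 1 ≤ N) : mesh N ^ d * (N : ℝ) ^ d = 1 := by
  have : (N : ℝ) ≠ 0 := by exact_mod_cast (by omega : N ≠ 0)
  rw [← mul_pow]; unfold mesh; field_simp; simp

theorem discretePi_mem {d N : ℕ} (hN : 1 ≤ N) (Vk : Fin d → ℝ → ℝ) :
    discretePi N Vk ∈ PPos d N := by
  refine ⟨discretePi_pos hN Vk, ?_⟩
  have h1 : ∀ k, mesh N * ∑ a : Fin N, discretePi1 N (Vk k) a = 1 := by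
    intro k
    unfold discretePi1
    rw [← Finset.sum_div, ← mul_div_assoc]
    exact div_self (discreteZ_pos hN _).ne'
  have h2 : ∑ j : Idx d N, discretePi N Vk j = ∏ k, ∑ a : Fin N, discretePi1 N (Vk k) a :=
    (Fintype.prod_sum fun k a => discretePi1 N (Vk k) a).symm
  calc mesh N ^ d * ∑ j : Idx d N, discretePi N Vk j
      = ∏ k : Fin d, mesh N * ∑ a : Fin N, discretePi1 N (Vk k) a := by
        rw [h2, Finset.prod_mul_distrib]; simp
    _ = 1 := by simp [h1]

open Function in
theorem discretePi_update {d N : ℕ} (Vk : Fin d → ℝ → ℝ) (i : Idx d N) (k : Fin d) (b : Fin N) :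
    discretePi N Vk (update i k b) =
      discretePi N Vk i * Real.exp (avgV N (Vk k) (i k) - avgV N (Vk k) b) := by
  unfold discretePi
  rw [← Finset.mul_prod_erase _ _ (Finset.mem_univ k),
    ← Finset.mul_prod_erase _ (fun k => discretePi1 N (Vk k) (i k)) (Finset.mem_univ k),
    update_self, Finset.prod_congr rfl (fun m hm => by
      rw [update_of_ne (Finset.ne_of_mem_erase hm)])]
  unfold discretePi1
  have : Real.exp (-avgV N (Vk k) b) = Real.exp (-avgV N (Vk k) (i k)) *
      Real.exp (avgV N (Vk k) (i k) - avgV N (Vk k) b) := by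
    rw [← Real.exp_add]; congr 1; ring
  rw [this]
  ring

-- The symmetric weight `√(Π i Π j) / h²` is the equilibrium flux of the chain, because the product
-- structure leaves only the potential difference in direction `k`.
open Function in
theorem sqrt_discretePi_update {d N : ℕ} (hN : 1 ≤ N) (Vk : Fin d → ℝ → ℝ) (i : Idx d N)
    (k : Fin d) {b : Fin N} (h : Adj (i k) b) :
    Real.sqrt (discretePi N Vk i * discretePi N Vk (update i k b)) / mesh N ^ 2 =
      discretePi N Vk i * jumpRate (avgV N (Vk k)) (i k) b := by
  have hP := discretePi_pos hN Vk i
  rw [discretePi_update, jumpRate, if_pos h]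
  have : discretePi N Vk i * (discretePi N Vk i *
      Real.exp (avgV N (Vk k) (i k) - avgV N (Vk k) b)) =
      (discretePi N Vk i * Real.exp ((avgV N (Vk k) (i k) - avgV N (Vk k) b) / 2)) ^ 2 := by
    rw [mul_pow, ← Real.exp_nat_mul]
    push_cast
    rw [mul_div_cancel₀ _ two_ne_zero]
    ring
  rw [this, Real.sqrt_sq (by positivity)]
  ring

open Function in
theorem discretePi_detailedBalance {d N : ℕ} (Vk : Fin d → ℝ → ℝ)
    (i : Idx d N) (k : Fin d) (b : Fin N) :
    discretePi N Vk i * jumpRate (avgV N (Vk k)) (i k) b =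
      discretePi N Vk (update i k b) * jumpRate (avgV N (Vk k)) b (i k) := by
  rw [discretePi_update]
  unfold jumpRate
  by_cases h : Adj (i k) b
  · rw [if_pos h, if_pos h.symm]
    have : Real.exp ((avgV N (Vk k) (i k) - avgV N (Vk k) b) / 2) =
      Real.exp (avgV N (Vk k) (i k) - avgV N (Vk k) b) *
        Real.exp ((avgV N (Vk k) b - avgV N (Vk k) (i k)) / 2) := by
      rw [← Real.exp_add]; congr 1; ring
    rw [this]
    ring
  · rw [if_neg h, if_neg fun hc => h hc.symm]
    ring

/-- The conductance of an edge of the grid. -/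
noncomputable def conductance {d N : ℕ} (Vk : Fin d → ℝ → ℝ) (i j : Idx d N) : ℝ :=
  if Nbh i j then Real.sqrt (discretePi N Vk i * discretePi N Vk j) / mesh N ^ 2 else 0

theorem conductance_comm {d N : ℕ} (Vk : Fin d → ℝ → ℝ) (i j : Idx d N) :
    conductance Vk i j = conductance Vk j i := by
  unfold conductance
  rw [mul_comm]
  by_cases h : Nbh i j
  · rw [if_pos h, if_pos h.symm]
  · rw [if_neg h, if_neg fun hc => h hc.symm]

theorem conductance_nonneg {d N : ℕ} (Vk : Fin d → ℝ → ℝ) (i j : Idx d N) :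
    0 ≤ conductance Vk i j := by
  unfold conductance; split_ifs <;> positivity

open Function in
theorem sum_conductance_mul {d N : ℕ} (hN : 1 ≤ N) (Vk : Fin d → ℝ → ℝ) (i : Idx d N)
    (F : Idx d N → ℝ) :
    ∑ j, conductance Vk i j * F j = ∑ k, ∑ b,
      discretePi N Vk i * jumpRate (avgV N (Vk k)) (i k) b * F (update i k b) := by
  have h1 : ∑ j, conductance Vk i j * F j = ∑ j, if Nbh i j then
      Real.sqrt (discretePi N Vk i * discretePi N Vk j) / mesh N ^ 2 * F j else 0 := by
    unfold conductance
    simp only [ite_mul, zero_mul]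
  rw [h1, sum_nbh i (fun j => Real.sqrt (discretePi N Vk i * discretePi N Vk j) / mesh N ^ 2 * F j)]
  refine Finset.sum_congr rfl fun k _ => Finset.sum_congr rfl fun b _ => ?_
  split_ifs with h
  · rw [sqrt_discretePi_update hN Vk i k h]
  · rw [jumpRate, if_neg h]; ring

/-! ### Entropy and Fisher information as functions of the cell values -/

/-- The density with respect to the discrete steady state. -/
noncomputable def relDensity {d N : ℕ} (Vk : Fin d → ℝ → ℝ) (U : Idx d N → ℝ) (i : Idx d N) : ℝ :=
  U i / discretePi N Vk i

theorem relDensity_pos {d N : ℕ} (hN : 1 ≤ N) (Vk : Fin d → ℝ → ℝ) {U : Idx d N → ℝ}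
    (hU : ∀ i, 0 < U i) (i : Idx d N) : 0 < relDensity Vk U i :=
  div_pos (hU i) (discretePi_pos hN Vk i)

/-- The relative entropy with respect to the discrete steady state. -/
noncomputable def gridEntropy {d N : ℕ} (Vk : Fin d → ℝ → ℝ) (U : Idx d N → ℝ) : ℝ :=
  mesh N ^ d * ∑ i, U i * Real.log (relDensity Vk U i)

/-- The gradient of `gridEntropy`. -/
noncomputable def gridEntropyGrad {d N : ℕ} (Vk : Fin d → ℝ → ℝ) (U : Idx d N → ℝ)
    (i : Idx d N) : ℝ :=
  Real.log (relDensity Vk U i) + 1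

/-- The discrete Fisher information in explicit form. -/
noncomputable def gridFisher {d N : ℕ} (Vk : Fin d → ℝ → ℝ) (U : Idx d N → ℝ) : ℝ :=
  mesh N ^ d * (1 / 2 * ∑ i, ∑ j, conductance Vk i j *
    fisherDensity (relDensity Vk U i) (relDensity Vk U j))

/-- The gradient of `gridFisher`. -/
noncomputable def gridFisherGrad {d N : ℕ} (Vk : Fin d → ℝ → ℝ) (U : Idx d N → ℝ)
    (i : Idx d N) : ℝ :=
  (∑ j, conductance Vk i j * fisherDensityDeriv (relDensity Vk U i) (relDensity Vk U j)) /
    discretePi N Vk i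

theorem logMean_mul_log_sub {a b : ℝ} (ha : 0 < a) (hb : 0 < b) :
    logMean a b * (Real.log a - Real.log b) = a - b := by
  unfold logMean
  split_ifs with h
  · simp [h]
  · have : Real.log a - Real.log b ≠ 0 := fun h0 =>
      h (Real.log_injOn_pos ha hb (sub_eq_zero.1 h0))
    rw [div_mul_cancel₀ _ this]

theorem logMean_nonneg {a b : ℝ} (ha : 0 < a) (hb : 0 < b) : 0 ≤ logMean a b := by
  unfold logMean
  split_ifs with h
  · exact ha.le
  · rcases le_total a b with h | h
    · exact div_nonneg_of_nonpos (by linarith) (by linarith [Real.log_le_log ha h])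
    · exact div_nonneg (by linarith) (by linarith [Real.log_le_log hb h])

/-- Differentials are gradients projected to zero mean; since only differences enter the operator,
the projection can be ignored. -/
theorem onsager_sub_const {d N : ℕ} (Vk : Fin d → ℝ → ℝ) (U Q : Idx d N → ℝ) (c : ℝ) :
    onsager Vk U (fun j => Q j - c) = onsager Vk U Q := by
  funext i
  simp [onsager]

theorem onsagerForm_sub_const {d N : ℕ} (Vk : Fin d → ℝ → ℝ) (U P Q : Idx d N → ℝ) (c e : ℝ) :
    onsagerForm Vk U (fun j => P j - c) (fun j => Q j - e) = onsagerForm Vk U P Q := by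
  simp [onsagerForm]

theorem onsagerForm_comm {d N : ℕ} (Vk : Fin d → ℝ → ℝ) (U P Q : Idx d N → ℝ) :
    onsagerForm Vk U P Q = onsagerForm Vk U Q P := by
  simp only [onsagerForm, mul_right_comm]

theorem onsagerForm_self_nonneg {d N : ℕ} (hN : 1 ≤ N) (Vk : Fin d → ℝ → ℝ) {U : Idx d N → ℝ}
    (hU : ∀ i, 0 < U i) (P : Idx d N → ℝ) : 0 ≤ onsagerForm Vk U P P := by
  have hh := mesh_pos hN
  refine mul_nonneg (by positivity) (mul_nonneg (by norm_num) (Finset.sum_nonneg fun i _ =>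
    Finset.sum_nonneg fun j _ => ?_))
  split_ifs
  · rw [mul_assoc]
    exact mul_nonneg (mul_nonneg (Real.sqrt_nonneg _)
      (logMean_nonneg (relDensity_pos hN Vk hU i) (relDensity_pos hN Vk hU j)))
      (mul_self_nonneg _)
  · exact le_rfl

theorem onsagerForm_sub_smul {d N : ℕ} (Vk : Fin d → ℝ → ℝ) (U P Q : Idx d N → ℝ) (c : ℝ) :
    onsagerForm Vk U (fun i => P i - c * Q i) (fun i => P i - c * Q i) =
      onsagerForm Vk U P P - 2 * c * onsagerForm Vk U P Q + c ^ 2 * onsagerForm Vk U Q Q := by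
  simp only [onsagerForm, Finset.mul_sum, ← Finset.sum_add_distrib, ← Finset.sum_sub_distrib]
  refine Finset.sum_congr rfl fun i _ => Finset.sum_congr rfl fun j _ => ?_
  split_ifs <;> ring

/-- The heat flow is the gradient flow of the entropy. -/
theorem onsager_entropyGrad {d N : ℕ} (hN : 1 ≤ N) (Vk : Fin d → ℝ → ℝ) {U : Idx d N → ℝ}
    (hU : ∀ i, 0 < U i) (i : Idx d N) :
    onsager Vk U (gridEntropyGrad Vk U) i =
      ∑ j, conductance Vk i j * (relDensity Vk U i - relDensity Vk U j) := by
  unfold onsager conductance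
  refine Finset.sum_congr rfl fun j _ => ?_
  split_ifs
  · rw [← logMean_mul_log_sub (relDensity_pos hN Vk hU i) (relDensity_pos hN Vk hU j)]
    simp only [edgeWeight, gridEntropyGrad, relDensity]
    ring
  · ring

theorem onsager_entropyGrad_eq_generator {d N : ℕ} (hN : 1 ≤ N) (Vk : Fin d → ℝ → ℝ)
    {U : Idx d N → ℝ} (hU : ∀ i, 0 < U i) (i : Idx d N) :
    onsager Vk U (gridEntropyGrad Vk U) i =
      -(discretePi N Vk i * gridGenerator (fun k => avgV N (Vk k)) (relDensity Vk U) i) := by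
  rw [onsager_entropyGrad hN Vk hU,
    sum_conductance_mul hN Vk i (fun j => relDensity Vk U i - relDensity Vk U j)]
  simp only [gridGenerator, dirGenerator, Finset.mul_sum, ← Finset.sum_neg_distrib]
  refine Finset.sum_congr rfl fun k _ => Finset.sum_congr rfl fun b _ => ?_
  ring

theorem onsagerForm_entropyGrad {d N : ℕ} (hN : 1 ≤ N) (Vk : Fin d → ℝ → ℝ) {U : Idx d N → ℝ}
    (hU : ∀ i, 0 < U i) :
    onsagerForm Vk U (gridEntropyGrad Vk U) (gridEntropyGrad Vk U) = gridFisher Vk U := by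
  unfold onsagerForm gridFisher conductance fisherDensity
  congr 2
  refine Finset.sum_congr rfl fun i _ => Finset.sum_congr rfl fun j _ => ?_
  split_ifs
  · rw [← logMean_mul_log_sub (relDensity_pos hN Vk hU i) (relDensity_pos hN Vk hU j)]
    simp only [edgeWeight, gridEntropyGrad, relDensity]
    ring
  · ring

/-- The convex decay of the entropy along the heat flow, in differential form. -/
theorem fisher_le_onsagerForm {d N : ℕ} (hN : 1 ≤ N) (Vk : Fin d → ℝ → ℝ) {U : Idx d N → ℝ}
    (hU : ∀ i, 0 < U i) {lam : ℝ} (hlam : 0 ≤ lam)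
    (hv : ∀ k, ∀ a b c : Fin N, (a : ℕ) + 1 = b → (b : ℕ) + 1 = c →
      mesh N ^ 2 * lam ≤ avgV N (Vk k) a + avgV N (Vk k) c - 2 * avgV N (Vk k) b) :
    2 * lambdaH lam (mesh N) * gridFisher Vk U ≤
      onsagerForm Vk U (gridFisherGrad Vk U) (gridEntropyGrad Vk U) := by
  have hh := mesh_pos hN
  set P := discretePi N Vk with hPdef
  set ρ := relDensity Vk U with hρdef
  set L := gridGenerator (fun k => avgV N (Vk k)) ρ with hL
  have hP : ∀ i, 0 < P i := discretePi_pos hN Vk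
  set S := ∑ i, ∑ j, conductance Vk i j * (fisherDensityDeriv (ρ i) (ρ j) * L i) with hS
  have h1 : onsagerForm Vk U (gridFisherGrad Vk U) (gridEntropyGrad Vk U) = -(mesh N ^ d * S) := by
    rw [← pairing_onsager, pairing, hS, ← mul_neg, ← Finset.sum_neg_distrib]
    congr 1
    refine Finset.sum_congr rfl fun i _ => ?_
    rw [onsager_entropyGrad_eq_generator hN Vk hU, gridFisherGrad]
    rw [show ∀ A B C : ℝ, A / B * -(B * C) = -(A / B * B * C) by intros; ring,
      div_mul_cancel₀ _ (hP i).ne', Finset.sum_mul]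
    congr 1
    exact Finset.sum_congr rfl fun j _ => by ring
  -- Symmetrising `S` over the two ends of an edge brings it into the form of `grid_decay`.
  have h2 : S = ∑ i, ∑ j, conductance Vk i j * (fisherDensityDeriv (ρ j) (ρ i) * L j) := by
    rw [hS, Finset.sum_comm]
    exact Finset.sum_congr rfl fun j _ => Finset.sum_congr rfl fun i _ => by
      rw [conductance_comm]
  have h3 : 2 * S = ∑ i, ∑ j, conductance Vk i j *
      (fisherDensityDeriv (ρ i) (ρ j) * L i + fisherDensityDeriv (ρ j) (ρ i) * L j) := by
    rw [two_mul]
    nth_rewrite 2 [h2]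
    simp only [hS, ← Finset.sum_add_distrib, ← mul_add]
  have h4 := grid_decay hN (fun k => avgV N (Vk k)) hP (relDensity_pos hN Vk hU)
    (discretePi_detailedBalance Vk) (by positivity) hv
  rw [Finset.sum_congr rfl fun i _ => sum_conductance_mul hN Vk i _] at h3
  rw [← h3] at h4
  have h5 : gridFisher Vk U = mesh N ^ d * (1 / 2 * ∑ i, ∑ k, ∑ b,
      P i * jumpRate (avgV N (Vk k)) (i k) b *
        fisherDensity (ρ i) (ρ (Function.update i k b))) := by
    unfold gridFisher
    rw [Finset.sum_congr rfl fun i _ => sum_conductance_mul hN Vk i _]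
  have h6 : 4 * ((1 - Real.exp (-(mesh N ^ 2 * lam) / 2)) / mesh N ^ 2) =
      2 * lambdaH lam (mesh N) := by
    unfold lambdaH
    rw [show -(mesh N ^ 2 * lam) / 2 = -(mesh N ^ 2 / 2 * lam) by ring]
    ring
  rw [h6] at h4
  rw [h1, h5]
  set T := ∑ i, ∑ k, ∑ b, P i * jumpRate (avgV N (Vk k)) (i k) b *
        fisherDensity (ρ i) (ρ (Function.update i k b))
  have h7 : mesh N ^ d * (2 * S) ≤ mesh N ^ d * (-(2 * lambdaH lam (mesh N)) * T) := by gcongr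
  linarith

/-! ### Derivatives along curves -/

theorem hasDerivWithinAt_gridEntropy {d N : ℕ} (hN : 1 ≤ N) (Vk : Fin d → ℝ → ℝ)
    {U : ℝ → Idx d N → ℝ} {U' : Idx d N → ℝ} {s : Set ℝ} {t : ℝ}
    (hU : ∀ i, HasDerivWithinAt (fun τ => U τ i) (U' i) s t) (hpos : ∀ i, 0 < U t i) :
    HasDerivWithinAt (fun τ => gridEntropy Vk (U τ)) (pairing (gridEntropyGrad Vk (U t)) U') s t := by
  unfold gridEntropy pairing
  refine HasDerivWithinAt.const_mul _ (HasDerivWithinAt.fun_sum fun i _ => ?_)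
  have hP := discretePi_pos hN Vk i
  have hlog := ((hU i).div_const (discretePi N Vk i)).log (relDensity_pos hN Vk hpos i).ne'
  refine ((hU i).mul hlog).congr_deriv ?_
  have := hpos i
  simp only [gridEntropyGrad, relDensity]
  field_simp

theorem hasDerivWithinAt_gridFisher {d N : ℕ} (hN : 1 ≤ N) (Vk : Fin d → ℝ → ℝ)
    {U : ℝ → Idx d N → ℝ} {U' : Idx d N → ℝ} {s : Set ℝ} {t : ℝ}
    (hU : ∀ i, HasDerivWithinAt (fun τ => U τ i) (U' i) s t) (hpos : ∀ i, 0 < U t i) :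
    HasDerivWithinAt (fun τ => gridFisher Vk (U τ)) (pairing (gridFisherGrad Vk (U t)) U') s t := by
  have hr : ∀ i, HasDerivWithinAt (fun τ => relDensity Vk (U τ) i) (U' i / discretePi N Vk i) s t :=
    fun i => (hU i).div_const _
  have hρ := relDensity_pos hN Vk hpos
  have hφ : ∀ i j, HasDerivWithinAt
      (fun τ => fisherDensity (relDensity Vk (U τ) i) (relDensity Vk (U τ) j))
      (fisherDensityDeriv (relDensity Vk (U t) i) (relDensity Vk (U t) j) *
          (U' i / discretePi N Vk i) +
        fisherDensityDeriv (relDensity Vk (U t) j) (relDensity Vk (U t) i) *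
          (U' j / discretePi N Vk j)) s t := by
    intro i j
    refine (((hr i).sub (hr j)).mul (((hr i).log (hρ i).ne').sub ((hr j).log (hρ j).ne'))).congr_deriv
      ?_
    have h1 := (hρ i).ne'
    have h2 := (hρ j).ne'
    simp only [fisherDensityDeriv, Pi.sub_apply]
    field_simp
    ring
  have hsum : HasDerivWithinAt (fun τ => gridFisher Vk (U τ)) _ s t :=
    HasDerivWithinAt.const_mul (mesh N ^ d) (HasDerivWithinAt.const_mul (1 / 2 : ℝ)
      (HasDerivWithinAt.fun_sum fun i (_ : i ∈ Finset.univ) =>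
        HasDerivWithinAt.fun_sum fun j (_ : j ∈ Finset.univ) =>
          HasDerivWithinAt.const_mul (conductance Vk i j) (hφ i j)))
  refine hsum.congr_deriv ?_
  unfold pairing
  congr 1
  set ρ := relDensity Vk (U t)
  have e1 : ∑ i, gridFisherGrad Vk (U t) i * U' i = ∑ i, ∑ j, conductance Vk i j *
      (fisherDensityDeriv (ρ i) (ρ j) * (U' i / discretePi N Vk i)) := by
    refine Finset.sum_congr rfl fun i _ => ?_
    rw [gridFisherGrad, div_mul_eq_mul_div, mul_div_assoc, Finset.sum_mul]
    exact Finset.sum_congr rfl fun j _ => by ring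
  have e2 : ∑ i, gridFisherGrad Vk (U t) i * U' i = ∑ i, ∑ j, conductance Vk i j *
      (fisherDensityDeriv (ρ j) (ρ i) * (U' j / discretePi N Vk j)) := by
    rw [e1, Finset.sum_comm]
    exact Finset.sum_congr rfl fun j _ => Finset.sum_congr rfl fun i _ => by
      rw [conductance_comm]
  simp only [mul_add, Finset.sum_add_distrib]
  rw [← e1, ← e2]
  ring

/-- Only the values of `F` on positive densities are known, which suffices because the test
directions have zero mean and positivity is an open condition. Since `h^d N^d = 1`, the subtracted
constant is the mean of `g`. -/
theorem differential_eq {d N : ℕ} (hN : 1 ≤ N) {F G : (Idx d N → ℝ) → ℝ} {U g : Idx d N → ℝ}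
    (hU : U ∈ PPos d N) (hFG : ∀ U ∈ PPos d N, F U = G U)
    (hG : ∀ w, HasDerivAt (fun t : ℝ => G (U + t • w)) (pairing g w) 0) :
    differential F U = fun j => g j - mesh N ^ d * ∑ i, g i := by
  funext j
  have hh := mesh_pos hN
  set w : Idx d N → ℝ := Pi.single j 1 - fun _ => mesh N ^ d with hw
  have hw0 : ∑ i, w i = 0 := by
    have := mesh_pow_mul_card (d := d) hN
    simp only [hw, Pi.sub_apply, Finset.sum_sub_distrib, Finset.sum_pi_single', Finset.mem_univ,
      if_true, Finset.sum_const, Finset.card_univ, Fintype.card_pi, Fintype.card_fin,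
      Finset.prod_const, nsmul_eq_mul]
    push_cast
    linarith
  have hmem : ∀ᶠ t : ℝ in nhds 0, U + t • w ∈ PPos d N := by
    have hp : ∀ᶠ t : ℝ in nhds 0, ∀ i, 0 < U i + t * w i := by
      rw [Filter.eventually_all]
      intro i
      have hc : Continuous fun t : ℝ => U i + t * w i := by fun_prop
      exact continuousAt_const.eventually_lt hc.continuousAt (by simpa using hU.1 i)
    filter_upwards [hp] with t ht
    refine ⟨fun i => by simpa using ht i, ?_⟩
    simp only [Pi.add_apply, Pi.smul_apply, smul_eq_mul, Finset.sum_add_distrib, ← Finset.mul_sum,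
      hw0]
    simpa using hU.2
  have hF : HasDerivAt (fun t : ℝ => F (U + t • w)) (pairing g w) 0 :=
    (hG w).congr_of_eventuallyEq (hmem.mono fun t ht => hFG _ ht)
  unfold differential lineDeriv
  rw [hF.deriv, pairing, ← mul_assoc, inv_mul_cancel₀ (by positivity), one_mul]
  simp only [hw, Pi.sub_apply, mul_sub, Finset.sum_sub_distrib, ← Finset.sum_mul]
  rw [mul_comm (mesh N ^ d)]
  simp [Pi.single_apply]

theorem hasDerivAt_gridEntropy_line {d N : ℕ} (hN : 1 ≤ N) (Vk : Fin d → ℝ → ℝ)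
    {U : Idx d N → ℝ} (hU : ∀ i, 0 < U i) (w : Idx d N → ℝ) :
    HasDerivAt (fun t : ℝ => gridEntropy Vk (U + t • w)) (pairing (gridEntropyGrad Vk U) w) 0 := by
  have h := hasDerivWithinAt_gridEntropy hN Vk (U := fun t => U + t • w) (U' := w) (s := Set.univ)
    (t := 0) (fun i => by
      simpa using (((hasDerivAt_id (0 : ℝ)).mul_const (w i)).const_add (U i)))
    (by simpa using hU)
  simpa using h

theorem hasDerivAt_gridFisher_line {d N : ℕ} (hN : 1 ≤ N) (Vk : Fin d → ℝ → ℝ)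
    {U : Idx d N → ℝ} (hU : ∀ i, 0 < U i) (w : Idx d N → ℝ) :
    HasDerivAt (fun t : ℝ => gridFisher Vk (U + t • w)) (pairing (gridFisherGrad Vk U) w) 0 := by
  have h := hasDerivWithinAt_gridFisher hN Vk (U := fun t => U + t • w) (U' := w) (s := Set.univ)
    (t := 0) (fun i => by
      simpa using (((hasDerivAt_id (0 : ℝ)).mul_const (w i)).const_add (U i)))
    (by simpa using hU)
  simpa using h

/-! ### The unit cube and its cells -/

theorem unitCube_eq_preimage (d : ℕ) :
    unitCube d = EuclideanSpace.equiv (Fin d) ℝ ⁻¹' Set.pi Set.univ (fun _ => Set.Icc (0 : ℝ) 1) := by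
  ext x
  simp only [unitCube, Set.mem_ofPred_eq, Set.mem_preimage, Set.mem_univ_pi]
  rfl

theorem isCompact_unitCube (d : ℕ) : IsCompact (unitCube d) := by
  rw [unitCube_eq_preimage]
  exact (EuclideanSpace.equiv (Fin d) ℝ).toHomeomorph.isCompact_preimage.2
    (isCompact_univ_pi fun _ => isCompact_Icc)

theorem convex_unitCube (d : ℕ) : Convex ℝ (unitCube d) := by
  rw [unitCube_eq_preimage]
  exact (convex_pi fun _ _ => convex_Icc (0 : ℝ) 1).linear_preimage
    (EuclideanSpace.equiv (Fin d) ℝ).toLinearEquiv.toLinearMap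

theorem interior_unitCube_nonempty (d : ℕ) : (interior (unitCube d)).Nonempty := by
  rw [unitCube_eq_preimage]
  have h := (EuclideanSpace.equiv (Fin d) ℝ).toHomeomorph.preimage_interior
    (Set.pi Set.univ (fun _ => Set.Icc (0 : ℝ) 1))
  refine ⟨(EuclideanSpace.equiv (Fin d) ℝ).symm (fun _ => 1 / 2), ?_⟩
  have h' : (EuclideanSpace.equiv (Fin d) ℝ).symm (fun _ => (1 / 2 : ℝ)) ∈
      (EuclideanSpace.equiv (Fin d) ℝ).toHomeomorph ⁻¹'
        interior (Set.pi Set.univ (fun _ => Set.Icc (0 : ℝ) 1)) := by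
    rw [interior_pi_set Set.finite_univ, Set.mem_preimage, Set.mem_pi]
    intro i _
    rw [interior_Icc]
    simp only [ContinuousLinearEquiv.coe_toHomeomorph, ContinuousLinearEquiv.apply_symm_apply]
    norm_num
  rw [h] at h'
  exact h'

theorem uniqueDiffOn_unitCube (d : ℕ) : UniqueDiffOn ℝ (unitCube d) :=
  uniqueDiffOn_convex (convex_unitCube d) (interior_unitCube_nonempty d)

theorem measurableSet_cell {d N : ℕ} (j : Idx d N) : MeasurableSet (cell N j) := by
  have : cell N j = ⋂ k, (fun x : EuclideanSpace ℝ (Fin d) => x k) ⁻¹'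
      Set.Ioo (mesh N * ((j k : ℕ) : ℝ)) (mesh N * (((j k : ℕ) : ℝ) + 1)) := by
    ext x; simp [cell]
  rw [this]
  exact MeasurableSet.iInter fun k => measurableSet_Ioo.preimage (by fun_prop)

theorem mesh_mul_succ_le {N : ℕ} (a : Fin N) : mesh N * (((a : ℕ) : ℝ) + 1) ≤ 1 := by
  have hN : (0 : ℝ) < N := by exact_mod_cast (Nat.zero_le _).trans_lt a.2
  have : ((a : ℕ) : ℝ) + 1 ≤ N := by exact_mod_cast a.2
  unfold mesh
  rw [one_div_mul_eq_div, div_le_one hN]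
  exact this

theorem mesh_nonneg (N : ℕ) : 0 ≤ mesh N := by unfold mesh; positivity

theorem cell_subset_unitCube {d N : ℕ} (j : Idx d N) : cell N j ⊆ unitCube d := by
  intro x hx k
  have := hx k
  have h1 := mesh_mul_succ_le (j k)
  have h2 : 0 ≤ mesh N * ((j k : ℕ) : ℝ) := mul_nonneg (mesh_nonneg N) (by positivity)
  exact ⟨by linarith [this.1], by linarith [this.2]⟩

theorem cell_disjoint {d N : ℕ} (hN : 1 ≤ N) {i j : Idx d N} {x : EuclideanSpace ℝ (Fin d)}
    (hi : x ∈ cell N i) (hj : x ∈ cell N j) : i = j := by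
  funext k
  have h1 := hi k
  have h2 := hj k
  have hh := mesh_pos hN
  have h3 := lt_of_mul_lt_mul_left (h1.1.trans h2.2) hh.le
  have h4 := lt_of_mul_lt_mul_left (h2.1.trans h1.2) hh.le
  have h5 : ((i k : ℕ)) < (j k : ℕ) + 1 := by exact_mod_cast h3
  have h6 : ((j k : ℕ)) < (i k : ℕ) + 1 := by exact_mod_cast h4
  exact Fin.ext (by omega)

theorem pcFun_of_mem {d N : ℕ} (hN : 1 ≤ N) (U : Idx d N → ℝ) {j : Idx d N}
    {x : EuclideanSpace ℝ (Fin d)} (hx : x ∈ cell N j) : pcFun U x = U j := by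
  unfold pcFun
  rw [Finset.sum_eq_single j]
  · rw [Set.indicator_of_mem hx]
  · intro i _ hij
    rw [Set.indicator_of_notMem]
    exact fun hi => hij (cell_disjoint hN hi hx)
  · simp

/-- Integrals of expressions in a piecewise constant function split into integrals over cells. -/
theorem integral_pcFun {d N : ℕ} (hN : 1 ≤ N) (U : Idx d N → ℝ)
    (Φ : ℝ → EuclideanSpace ℝ (Fin d) → ℝ) (h0 : ∀ x, Φ 0 x = 0)
    (hint : ∀ j, IntegrableOn (Φ (U j)) (cell N j)) :
    ∫ x in unitCube d, Φ (pcFun U x) x = ∑ j, ∫ x in cell N j, Φ (U j) x := by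
  have hpt : ∀ x, Φ (pcFun U x) x = ∑ j, (cell N j).indicator (Φ (U j)) x := by
    intro x
    by_cases hx : ∃ j, x ∈ cell N j
    · obtain ⟨j, hj⟩ := hx
      rw [pcFun_of_mem hN U hj, Finset.sum_eq_single j]
      · rw [Set.indicator_of_mem hj]
      · intro i _ hij
        rw [Set.indicator_of_notMem]
        exact fun hi => hij (cell_disjoint hN hi hj)
      · simp
    -- Off the open cells the piecewise constant function is `0`; this is where `h0` enters.
    · push Not at hx
      have : pcFun U x = 0 := by
        unfold pcFun
        exact Finset.sum_eq_zero fun j _ => Set.indicator_of_notMem (hx j) _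
      rw [this, h0]
      exact (Finset.sum_eq_zero fun j _ => Set.indicator_of_notMem (hx j) _).symm
  simp only [hpt]
  rw [integral_finsetSum]
  · refine Finset.sum_congr rfl fun j _ => ?_
    rw [setIntegral_indicator (measurableSet_cell j),
      Set.inter_eq_self_of_subset_right (cell_subset_unitCube j)]
  · intro j _
    exact ((integrable_indicator_iff (measurableSet_cell j)).2 (hint j)).integrableOn

theorem setIntegral_cell_prod {d N : ℕ} (j : Idx d N) (g : Fin d → ℝ → ℝ) :
    ∫ x in cell N j, ∏ k, g k (x k) =
      ∏ k, ∫ r in (mesh N * ((j k : ℕ) : ℝ))..(mesh N * (((j k : ℕ) : ℝ) + 1)), g k r := by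
  have h1 : ∀ x : EuclideanSpace ℝ (Fin d), (cell N j).indicator (fun x => ∏ k, g k (x k)) x =
      ∏ k, (Set.Ioo (mesh N * ((j k : ℕ) : ℝ)) (mesh N * (((j k : ℕ) : ℝ) + 1))).indicator
        (g k) (x k) := by
    intro x
    by_cases hx : x ∈ cell N j
    · rw [Set.indicator_of_mem hx]
      exact Finset.prod_congr rfl fun k _ => by rw [Set.indicator_of_mem (hx k)]
    · rw [Set.indicator_of_notMem hx]
      have : ∃ k, x k ∉ Set.Ioo (mesh N * ((j k : ℕ) : ℝ)) (mesh N * (((j k : ℕ) : ℝ) + 1)) := by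
        by_contra! hc
        exact hx hc
      obtain ⟨k, hk⟩ := this
      exact (Finset.prod_eq_zero (Finset.mem_univ k) (Set.indicator_of_notMem hk _)).symm
  rw [← integral_indicator (measurableSet_cell j)]
  simp only [h1]
  have h2 := (EuclideanSpace.volume_preserving_symm_measurableEquiv_toLp (Fin d)).integral_comp'
    (fun y : Fin d → ℝ => ∏ k, (Set.Ioo (mesh N * ((j k : ℕ) : ℝ))
      (mesh N * (((j k : ℕ) : ℝ) + 1))).indicator (g k) (y k))
  refine h2.trans ?_
  rw [integral_fintype_prod_volume_eq_prod (fun k => (Set.Ioo (mesh N * ((j k : ℕ) : ℝ))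
      (mesh N * (((j k : ℕ) : ℝ) + 1))).indicator (g k))]
  refine Finset.prod_congr rfl fun k _ => ?_
  rw [integral_indicator measurableSet_Ioo, intervalIntegral.integral_of_le,
    integral_Ioc_eq_integral_Ioo]
  exact mul_le_mul_of_nonneg_left (by linarith) (mesh_nonneg N)

theorem integral_one_row {N : ℕ} (a : ℝ) :
    ∫ _ in (mesh N * a)..(mesh N * (a + 1)), (1 : ℝ) = mesh N := by
  rw [intervalIntegral.integral_const, smul_eq_mul]; ring

theorem setIntegral_cell_const {d N : ℕ} (j : Idx d N) (c : ℝ) :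
    ∫ _ in cell N j, c = mesh N ^ d * c := by
  have h := setIntegral_cell_prod j (fun _ _ => (1 : ℝ))
  simp only [integral_one_row, Finset.prod_const, Finset.card_univ, Fintype.card_fin,
    one_pow] at h
  have : ∫ _ in cell N j, c = ∫ _ in cell N j, c * (1 : ℝ) := by simp
  rw [this, integral_const_mul, h]
  ring

theorem setIntegral_cell_coord {d N : ℕ} (hN : 1 ≤ N) (j : Idx d N) (k : Fin d) (f : ℝ → ℝ) :
    ∫ x in cell N j, f (x k) = mesh N ^ d * avgV N f (j k) := by
  have hh := mesh_pos hN
  have h := setIntegral_cell_prod j (fun l => if l = k then f else fun _ => (1 : ℝ))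
  have e1 : ∀ x : EuclideanSpace ℝ (Fin d),
      ∏ l, (if l = k then f else fun _ => (1 : ℝ)) (x l) = f (x k) := by
    intro x
    rw [Finset.prod_eq_single k] <;> simp +contextual
  simp only [e1] at h
  rw [h, ← Finset.mul_prod_erase _ _ (Finset.mem_univ k), if_pos rfl,
    Finset.prod_congr rfl (fun l hl => by
      rw [if_neg (Finset.ne_of_mem_erase hl), integral_one_row]),
    Finset.prod_const, Finset.card_erase_of_mem (Finset.mem_univ k), Finset.card_univ,
    Fintype.card_fin]
  unfold avgV
  obtain ⟨n, rfl⟩ : ∃ n, d = n + 1 := ⟨d - 1, by have := k.2; omega⟩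
  rw [Nat.add_sub_cancel, pow_succ]
  field_simp

/-! ### The potential restricted to a coordinate axis -/

/-- The linear embedding of a coordinate axis. -/
noncomputable def axisMap {d : ℕ} (k : Fin d) : ℝ →L[ℝ] EuclideanSpace ℝ (Fin d) :=
  ContinuousLinearMap.toSpanSingleton ℝ (EuclideanSpace.single k 1)

theorem axisMap_apply {d : ℕ} (k l : Fin d) (r : ℝ) :
    axisMap k r l = if l = k then r else 0 := by
  simp [axisMap, ContinuousLinearMap.toSpanSingleton_apply]

theorem axisMap_preimage {d : ℕ} (k : Fin d) :
    axisMap k ⁻¹' unitCube d = Set.Icc (0 : ℝ) 1 := by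
  ext r
  constructor
  · intro h
    have := h k
    rwa [axisMap_apply, if_pos rfl] at this
  · intro h l
    rw [axisMap_apply]
    split_ifs
    · exact h
    · simp

/-- The summands `Vk k` carry no regularity assumption of their own; up to an additive constant they
are restrictions of `V` to axes, from which they inherit continuity and convexity. -/
theorem separable_axis {d : ℕ} {V : EuclideanSpace ℝ (Fin d) → ℝ} {Vk : Fin d → ℝ → ℝ}
    (hsep : IsSeparable V Vk) (k : Fin d) :
    ∃ c, ∀ r ∈ Set.Icc (0 : ℝ) 1, Vk k r = V (axisMap k r) + c := by
  refine ⟨-∑ l ∈ Finset.univ.erase k, Vk l 0, fun r hr => ?_⟩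
  rw [← axisMap_preimage k] at hr
  rw [hsep _ hr, ← Finset.add_sum_erase _ _ (Finset.mem_univ k), axisMap_apply, if_pos rfl,
    Finset.sum_congr rfl (fun l hl => by rw [axisMap_apply, if_neg (Finset.ne_of_mem_erase hl)])]
  ring

theorem continuousOn_axis {d : ℕ} {V : EuclideanSpace ℝ (Fin d) → ℝ} {Vk : Fin d → ℝ → ℝ}
    (hV : ContinuousOn V (unitCube d)) (hsep : IsSeparable V Vk) (k : Fin d) :
    ContinuousOn (Vk k) (Set.Icc (0 : ℝ) 1) := by
  obtain ⟨c, hc⟩ := separable_axis hsep k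
  refine ContinuousOn.congr ?_ hc
  refine ContinuousOn.add (hV.comp (axisMap k).continuous.continuousOn ?_) continuousOn_const
  rw [← axisMap_preimage k]
  exact Set.mapsTo_preimage _ _

theorem iteratedDerivWithin_axis {d : ℕ} {V : EuclideanSpace ℝ (Fin d) → ℝ}
    (hV : ContDiffOn ℝ 2 V (unitCube d)) {lam : ℝ} (hconv : IsLambdaConvex V lam) (k : Fin d)
    {r : ℝ} (hr : r ∈ Set.Icc (0 : ℝ) 1) :
    lam ≤ iteratedDerivWithin 2 (V ∘ axisMap k) (Set.Icc (0 : ℝ) 1) r := by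
  have hpre := axisMap_preimage k
  have hmem : axisMap k r ∈ unitCube d := by rwa [← hpre] at hr
  have h := (axisMap k).iteratedFDerivWithin_comp_right hV (uniqueDiffOn_unitCube d)
    (by rw [hpre]; exact uniqueDiffOn_Icc zero_lt_one) hmem (i := 2) le_rfl
  rw [hpre] at h
  rw [iteratedDerivWithin_eq_iteratedFDerivWithin, h,
    ContinuousMultilinearMap.compContinuousLinearMap_apply]
  have h2 := hconv _ hmem (EuclideanSpace.single k 1)
  have h3 : (fun _ : Fin 2 => axisMap k 1) =
      ![EuclideanSpace.single k 1, EuclideanSpace.single k 1] := by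
    funext i
    fin_cases i <;> simp [axisMap, ContinuousLinearMap.toSpanSingleton_apply]
  rw [h3]
  simpa using h2

theorem convexOn_axis {d : ℕ} {V : EuclideanSpace ℝ (Fin d) → ℝ}
    (hV : ContDiffOn ℝ 2 V (unitCube d)) {lam : ℝ} (hconv : IsLambdaConvex V lam) (k : Fin d) :
    ConvexOn ℝ (Set.Icc (0 : ℝ) 1) (fun r => V (axisMap k r) - lam / 2 * r ^ 2) := by
  set f := V ∘ axisMap k with hf
  set I := Set.Icc (0 : ℝ) 1 with hI
  have hu : UniqueDiffOn ℝ I := uniqueDiffOn_Icc zero_lt_one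
  have hfC : ContDiffOn ℝ 2 f I := by
    have := hV.comp_continuousLinearMap (axisMap k)
    rwa [axisMap_preimage] at this
  have hd1 : DifferentiableOn ℝ f I := hfC.differentiableOn (by norm_num)
  have hd2 : DifferentiableOn ℝ (derivWithin f I) I := by
    have := hfC.differentiableOn_iteratedDerivWithin (m := 1) (by norm_num) hu
    rwa [iteratedDerivWithin_one] at this
  have hs : interior I ⊆ I := interior_subset
  refine convexOn_of_hasDerivWithinAt2_nonneg (convex_Icc 0 1)
    (f' := fun r => derivWithin f I r - lam * r)
    (f'' := fun r => iteratedDerivWithin 2 f I r - lam) ?_ ?_ ?_ ?_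
  · exact hfC.continuousOn.sub (by fun_prop)
  · intro x hx
    refine (((hd1 x (hs hx)).hasDerivWithinAt.mono hs).sub
      (((hasDerivAt_pow 2 x).const_mul (lam / 2)).hasDerivWithinAt)).congr_deriv ?_
    simp; ring
  · intro x hx
    have := (hd2 x (hs hx)).hasDerivWithinAt.mono hs
    rw [iteratedDerivWithin_succ, iteratedDerivWithin_one]
    refine (this.sub (((hasDerivAt_id x).const_mul lam).hasDerivWithinAt)).congr_deriv ?_
    simp
  · intro x hx
    exact sub_nonneg.2 (iteratedDerivWithin_axis hV hconv k (hs hx))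

/-- The cell averages inherit the convexity of the potential. -/
theorem avgV_second_difference {d N : ℕ} (hN : 1 ≤ N) {V : EuclideanSpace ℝ (Fin d) → ℝ}
    {Vk : Fin d → ℝ → ℝ} (hV : ContDiffOn ℝ 2 V (unitCube d)) (hsep : IsSeparable V Vk) {lam : ℝ}
    (hconv : IsLambdaConvex V lam) (k : Fin d) (a b c : Fin N) (hab : (a : ℕ) + 1 = b)
    (hbc : (b : ℕ) + 1 = c) :
    mesh N ^ 2 * lam ≤ avgV N (Vk k) a + avgV N (Vk k) c - 2 * avgV N (Vk k) b := by
  have hh := mesh_pos hN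
  set h := mesh N with hhdef
  set v := Vk k with hv
  have hcont : ContinuousOn v (Set.Icc 0 1) := continuousOn_axis hV.continuousOn hsep k
  set A := h * (b : ℕ) with hA
  have hA0 : 0 ≤ A - h := by
    have : A - h = h * (a : ℕ) := by rw [hA, ← hab]; push_cast; ring
    rw [this]; positivity
  have hA1 : A + h + h ≤ 1 := by
    have := mesh_mul_succ_le c
    have e : A + h + h = h * ((c : ℕ) + 1) := by rw [hA, ← hbc]; push_cast; ring
    rw [e]; exact this
  -- Midpoint convexity of `v(r) - λ r² / 2`, up to a constant; the quadratic part contributes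
  -- exactly `h² λ`. Averaging this over the middle cell, with the two outer averages written as
  -- translates, gives the claim.
  have hdiff : ∀ r ∈ Set.Icc A (A + h), h ^ 2 * lam ≤ v (r - h) + v (r + h) - 2 * v r := by
    intro r hr
    obtain ⟨c0, hc0⟩ := separable_axis hsep k
    have m1 : r - h ∈ Set.Icc (0 : ℝ) 1 := ⟨by linarith [hr.1], by linarith [hr.2]⟩
    have m2 : r + h ∈ Set.Icc (0 : ℝ) 1 := ⟨by linarith [hr.1], by linarith [hr.2]⟩
    have m3 : r ∈ Set.Icc (0 : ℝ) 1 := ⟨by linarith [hr.1], by linarith [hr.2]⟩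
    have hcx := (convexOn_axis hV hconv k).2 m1 m2 (show (0 : ℝ) ≤ 1 / 2 by norm_num)
      (show (0 : ℝ) ≤ 1 / 2 by norm_num) (by norm_num)
    simp only [smul_eq_mul] at hcx
    rw [show 1 / 2 * (r - h) + 1 / 2 * (r + h) = r by ring] at hcx
    rw [hv, hc0 _ m1, hc0 _ m2, hc0 _ m3]
    nlinarith [hcx]
  have hii : ∀ s : ℝ, -h ≤ s → s ≤ h → IntervalIntegrable (fun r => v (r + s)) volume A (A + h) := by
    intro s hs1 hs2
    refine ContinuousOn.intervalIntegrable_of_Icc (by linarith) ?_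
    refine hcont.comp (by fun_prop) fun r hr => ⟨by linarith [hr.1], by linarith [hr.2]⟩
  have ea : avgV N v a = 1 / h * ∫ r in A..(A + h), v (r - h) := by
    rw [intervalIntegral.integral_comp_sub_right v h]
    unfold avgV
    rw [show h * ((a : ℕ) : ℝ) = A - h by rw [hA, ← hab]; push_cast; ring,
      show h * (((a : ℕ) : ℝ) + 1) = A + h - h by rw [hA, ← hab]; push_cast; ring]
  have ec : avgV N v c = 1 / h * ∫ r in A..(A + h), v (r + h) := by
    rw [intervalIntegral.integral_comp_add_right v h]
    unfold avgV
    rw [show h * ((c : ℕ) : ℝ) = A + h by rw [hA, ← hbc]; push_cast; ring,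
      show h * (((c : ℕ) : ℝ) + 1) = A + h + h by rw [hA, ← hbc]; push_cast; ring]
  have eb : avgV N v b = 1 / h * ∫ r in A..(A + h), v r := by
    unfold avgV
    rw [show h * (((b : ℕ) : ℝ) + 1) = A + h by rw [hA]; ring]
  have i1 := hii (-h) le_rfl (by linarith)
  have i2 := hii h (by linarith) le_rfl
  have i3 := hii 0 (by linarith) (by linarith)
  simp only [add_zero, ← sub_eq_add_neg] at i1 i3
  have hint : ∫ _ in A..(A + h), h ^ 2 * lam ≤
      ∫ r in A..(A + h), (v (r - h) + v (r + h) - 2 * v r) :=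
    intervalIntegral.integral_mono_on (by linarith) intervalIntegrable_const
      ((i1.add i2).sub (i3.const_mul 2)) hdiff
  rw [intervalIntegral.integral_const, smul_eq_mul, add_sub_cancel_left,
    intervalIntegral.integral_sub (i1.add i2) (i3.const_mul 2), intervalIntegral.integral_add i1 i2,
    intervalIntegral.integral_const_mul] at hint
  rw [ea, eb, ec]
  calc h ^ 2 * lam = 1 / h * (h * (h ^ 2 * lam)) := by field_simp
    _ ≤ 1 / h * _ := mul_le_mul_of_nonneg_left hint (by positivity)
    _ = _ := by ring

/-! ### The entropy of piecewise constant densities -/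

theorem partitionZ_pos {d : ℕ} {V : EuclideanSpace ℝ (Fin d) → ℝ}
    (hV : ContinuousOn V (unitCube d)) : 0 < partitionZ V := by
  unfold partitionZ
  have : NeZero (volume.restrict (unitCube d)) := by
    refine ⟨?_⟩
    rw [Ne, Measure.restrict_eq_zero]
    exact (Measure.measure_pos_of_nonempty_interior _ (interior_unitCube_nonempty d)).ne'
  exact integral_exp_pos
    ((Real.continuous_exp.comp_continuousOn hV.neg).integrableOn_compact (isCompact_unitCube d))

theorem log_discretePi {d N : ℕ} (hN : 1 ≤ N) (Vk : Fin d → ℝ → ℝ) (j : Idx d N) :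
    Real.log (discretePi N Vk j) =
      -∑ k, avgV N (Vk k) (j k) - ∑ k, Real.log (discreteZ N (Vk k)) := by
  unfold discretePi discretePi1
  rw [Real.log_prod (fun k _ => (div_pos (Real.exp_pos _) (discreteZ_pos hN _)).ne'),
    ← Finset.sum_neg_distrib, ← Finset.sum_sub_distrib]
  refine Finset.sum_congr rfl fun k _ => ?_
  rw [Real.log_div (Real.exp_pos _).ne' (discreteZ_pos hN _).ne', Real.log_exp]

/-- The entropy sees `V` on a cell only through its integral, and by separability this is `h^d`
times the sum of the one-dimensional cell averages that define the discrete steady state. The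
identity is thus exact, and the additive constant cancels in `entropyH`. -/
theorem entropy_pcFun {d N : ℕ} (hN : 1 ≤ N) {V : EuclideanSpace ℝ (Fin d) → ℝ}
    {Vk : Fin d → ℝ → ℝ} (hV : ContinuousOn V (unitCube d)) (hsep : IsSeparable V Vk)
    {U : Idx d N → ℝ} (hU : U ∈ PPos d N) :
    entropy V (pcFun U) = gridEntropy Vk U +
      (Real.log (partitionZ V) - ∑ k, Real.log (discreteZ N (Vk k))) := by
  have hZ := partitionZ_pos hV
  have hlog : ∀ (j : Idx d N) (x : EuclideanSpace ℝ (Fin d)),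
      U j * Real.log (U j / steadyState V x) =
        U j * (Real.log (U j) + Real.log (partitionZ V)) + U j * V x := by
    intro j x
    unfold steadyState
    rw [Real.log_div (hU.1 j).ne' (div_pos (Real.exp_pos _) hZ).ne',
      Real.log_div (Real.exp_pos _).ne' hZ.ne', Real.log_exp]
    ring
  have hVint : ∀ j : Idx d N, IntegrableOn V (cell N j) := fun j =>
    (hV.integrableOn_compact (isCompact_unitCube d)).mono_set (cell_subset_unitCube j)
  have hfin : ∀ j : Idx d N, volume (cell N j) ≠ ⊤ := fun j =>
    ((measure_mono (cell_subset_unitCube j)).trans_lt (isCompact_unitCube d).measure_lt_top).ne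
  have hcint : ∀ (j : Idx d N) (c : ℝ), IntegrableOn (fun _ => c) (cell N j) := fun j c =>
    integrableOn_const (hfin j)
  have hint : ∀ j : Idx d N, IntegrableOn (fun x => U j * Real.log (U j / steadyState V x))
      (cell N j) := by
    intro j
    simp only [hlog]
    exact (hcint j _).add ((hVint j).const_mul _)
  have hcellV : ∀ j : Idx d N, ∫ x in cell N j, V x = mesh N ^ d * ∑ k, avgV N (Vk k) (j k) := by
    intro j
    rw [setIntegral_congr_fun (measurableSet_cell j) (fun x hx => hsep x (cell_subset_unitCube j hx)),
      integral_finsetSum, Finset.mul_sum]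
    · exact Finset.sum_congr rfl fun k _ => setIntegral_cell_coord hN j k (Vk k)
    · intro k _
      have hck : ContinuousOn (fun x : EuclideanSpace ℝ (Fin d) => Vk k (x k)) (unitCube d) :=
        (continuousOn_axis hV hsep k).comp (by fun_prop) fun x hx => hx k
      exact (hck.integrableOn_compact (isCompact_unitCube d)).mono_set (cell_subset_unitCube j)
  unfold entropy
  rw [integral_pcFun hN U (fun u x => u * Real.log (u / steadyState V x)) (by simp) hint]
  have hcell : ∀ j : Idx d N, ∫ x in cell N j, U j * Real.log (U j / steadyState V x) =
      mesh N ^ d * (U j * Real.log (relDensity Vk U j)) + (mesh N ^ d * U j) *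
        (Real.log (partitionZ V) - ∑ k, Real.log (discreteZ N (Vk k))) := by
    intro j
    simp only [hlog]
    rw [integral_add (hcint j _) ((hVint j).const_mul _), integral_const_mul (U j) V,
      setIntegral_cell_const, hcellV, relDensity,
      Real.log_div (hU.1 j).ne' (discretePi_pos hN Vk j).ne', log_discretePi hN]
    ring
  rw [Finset.sum_congr rfl fun j _ => hcell j, Finset.sum_add_distrib, ← Finset.sum_mul,
    ← Finset.mul_sum, ← Finset.mul_sum, hU.2, one_mul]
  rfl

theorem entropyH_eq {d N : ℕ} (hN : 1 ≤ N) {V : EuclideanSpace ℝ (Fin d) → ℝ}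
    {Vk : Fin d → ℝ → ℝ} (hV : ContinuousOn V (unitCube d)) (hsep : IsSeparable V Vk)
    {U : Idx d N → ℝ} (hU : U ∈ PPos d N) : entropyH V Vk U = gridEntropy Vk U := by
  unfold entropyH
  rw [entropy_pcFun hN hV hsep hU, entropy_pcFun hN hV hsep (discretePi_mem hN Vk)]
  have : gridEntropy Vk (discretePi N Vk) = 0 := by
    unfold gridEntropy relDensity
    simp [div_self (discretePi_pos hN Vk _).ne']
  rw [this]
  ring

theorem fisherH_eq {d N : ℕ} (hN : 1 ≤ N) {V : EuclideanSpace ℝ (Fin d) → ℝ}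
    {Vk : Fin d → ℝ → ℝ} (hV : ContinuousOn V (unitCube d)) (hsep : IsSeparable V Vk)
    {U : Idx d N → ℝ} (hU : U ∈ PPos d N) : fisherH V Vk U = gridFisher Vk U := by
  unfold fisherH
  rw [pairing_onsager, differential_eq hN hU (fun U hU => entropyH_eq hN hV hsep hU)
    (hasDerivAt_gridEntropy_line hN Vk hU.1), onsagerForm_sub_const,
    onsagerForm_entropyGrad hN Vk hU.1]

theorem onsager_differential_fisherH {d N : ℕ} (hN : 1 ≤ N) {V : EuclideanSpace ℝ (Fin d) → ℝ}
    {Vk : Fin d → ℝ → ℝ} (hV : ContinuousOn V (unitCube d)) (hsep : IsSeparable V Vk)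
    {U : Idx d N → ℝ} (hU : U ∈ PPos d N) :
    onsager Vk U (differential (fisherH V Vk) U) = onsager Vk U (gridFisherGrad Vk U) := by
  rw [differential_eq hN hU (fun U hU => fisherH_eq hN hV hsep hU)
    (hasDerivAt_gridFisher_line hN Vk hU.1), onsager_sub_const]

/-- The `L¹` distance of piecewise constant functions. -/
theorem integral_abs_pcFun_sub {d N : ℕ} (hN : 1 ≤ N) (U W : Idx d N → ℝ) :
    ∫ x in unitCube d, |pcFun U x - pcFun W x| = mesh N ^ d * ∑ j, |U j - W j| := by
  have h : ∀ x : EuclideanSpace ℝ (Fin d), pcFun U x - pcFun W x = pcFun (U - W) x := by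
    intro x
    unfold pcFun
    rw [← Finset.sum_sub_distrib]
    refine Finset.sum_congr rfl fun j _ => ?_
    by_cases hx : x ∈ cell N j <;> simp [hx]
  simp only [h]
  rw [integral_pcFun hN (U - W) (fun u _ => |u|) (by simp), Finset.mul_sum]
  · exact Finset.sum_congr rfl fun j _ => setIntegral_cell_const j _
  · intro j
    exact integrableOn_const
      ((measure_mono (cell_subset_unitCube j)).trans_lt (isCompact_unitCube d).measure_lt_top).ne

/-! ### The Csiszár-Kullback-Pinsker inequality -/

theorem hasDerivAt_pinskerAux {t : ℝ} (ht : 0 < t) :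
    HasDerivAt (fun t : ℝ => Real.log t - (t - 1) * (5 * t + 1) / (2 * t * (t + 2)))
      ((t - 1) ^ 3 / (t ^ 2 * (t + 2) ^ 2)) t := by
  have h1 : HasDerivAt (fun t : ℝ => (t - 1) * (5 * t + 1)) (1 * (5 * t + 1) + (t - 1) * (5 * 1)) t :=
    ((hasDerivAt_id t).sub_const 1).mul (((hasDerivAt_id t).const_mul 5).add_const 1)
  have h2 : HasDerivAt (fun t : ℝ => 2 * t * (t + 2)) (2 * 1 * (t + 2) + 2 * t * 1) t :=
    ((hasDerivAt_id t).const_mul 2).mul ((hasDerivAt_id t).add_const 2)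
  have h0 : 2 * t * (t + 2) ≠ 0 := by positivity
  refine ((Real.hasDerivAt_log ht.ne').sub (h1.div h2 h0)).congr_deriv ?_
  have : t + 2 ≠ 0 := by positivity
  field_simp
  ring

/-- The rational function is chosen so that the bound is equivalent to `sq_sub_one_le_pinsker`. The
difference has derivative `(t - 1)³ / (t² (t + 2)²)`, hence its minimum `0` at `t = 1`. -/
theorem log_ge_pinsker {t : ℝ} (ht : 0 < t) :
    (t - 1) * (5 * t + 1) / (2 * t * (t + 2)) ≤ Real.log t := by
  set g : ℝ → ℝ := fun t => Real.log t - (t - 1) * (5 * t + 1) / (2 * t * (t + 2)) with hg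
  have hg1 : g 1 = 0 := by simp [hg]
  suffices h : g 1 ≤ g t by
    rw [hg1] at h
    exact sub_nonneg.1 h
  rcases le_total 1 t with h | h
  · have hpos : ∀ x ∈ Set.Ici (1 : ℝ), 0 < x := fun x hx => lt_of_lt_of_le one_pos hx
    refine monotoneOn_of_deriv_nonneg (convex_Ici 1)
      (fun x hx => (hasDerivAt_pinskerAux (hpos x hx)).continuousAt.continuousWithinAt)
      (fun x hx => (hasDerivAt_pinskerAux
        (hpos x (interior_subset hx))).differentiableAt.differentiableWithinAt)
      (fun x hx => ?_) Set.self_mem_Ici h h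
    have hx' : 1 ≤ x := interior_subset hx
    rw [(hasDerivAt_pinskerAux (hpos x hx')).deriv]
    have : 0 ≤ x - 1 := by linarith
    positivity
  · have hpos : ∀ x ∈ Set.Icc t 1, 0 < x := fun x hx => lt_of_lt_of_le ht hx.1
    refine antitoneOn_of_deriv_nonpos (convex_Icc t 1)
      (fun x hx => (hasDerivAt_pinskerAux (hpos x hx)).continuousAt.continuousWithinAt)
      (fun x hx => (hasDerivAt_pinskerAux
        (hpos x (interior_subset hx))).differentiableAt.differentiableWithinAt)
      (fun x hx => ?_) (Set.left_mem_Icc.2 h) (Set.right_mem_Icc.2 h) h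
    have hx' : x ∈ Set.Icc t 1 := interior_subset hx
    rw [(hasDerivAt_pinskerAux (hpos x hx')).deriv]
    refine div_nonpos_of_nonpos_of_nonneg ?_ (by positivity)
    have : 0 ≤ (1 - x) ^ 3 := pow_nonneg (by linarith [hx'.2]) 3
    nlinarith [this]

theorem sq_sub_one_le_pinsker {t : ℝ} (ht : 0 < t) :
    (t - 1) ^ 2 ≤ (2 * t + 4) / 3 * (t * Real.log t - t + 1) := by
  have h := log_ge_pinsker ht
  rw [div_le_iff₀ (by positivity)] at h
  nlinarith [h]

theorem sum_relDensity {d N : ℕ} (hN : 1 ≤ N) (Vk : Fin d → ℝ → ℝ) {U : Idx d N → ℝ}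
    (hU : U ∈ PPos d N) :
    ∑ i, mesh N ^ d * discretePi N Vk i * relDensity Vk U i = 1 := by
  rw [← hU.2, Finset.mul_sum]
  refine Finset.sum_congr rfl fun i _ => ?_
  have := (discretePi_pos hN Vk i).ne'
  unfold relDensity
  field_simp

theorem sum_mesh_mul_discretePi {d N : ℕ} (hN : 1 ≤ N) (Vk : Fin d → ℝ → ℝ) :
    ∑ i : Idx d N, mesh N ^ d * discretePi N Vk i = 1 := by
  rw [← (discretePi_mem hN Vk).2, Finset.mul_sum]

theorem gridEntropy_eq_sum {d N : ℕ} (hN : 1 ≤ N) (Vk : Fin d → ℝ → ℝ) {U : Idx d N → ℝ}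
    (hU : U ∈ PPos d N) :
    gridEntropy Vk U = ∑ i, mesh N ^ d * discretePi N Vk i *
      (relDensity Vk U i * Real.log (relDensity Vk U i) - relDensity Vk U i + 1) := by
  simp only [mul_add, mul_sub, Finset.sum_add_distrib, Finset.sum_sub_distrib, mul_one]
  rw [sum_relDensity hN Vk hU, sum_mesh_mul_discretePi hN, sub_add_cancel, gridEntropy,
    Finset.mul_sum]
  refine Finset.sum_congr rfl fun i _ => ?_
  have := (discretePi_pos hN Vk i).ne'
  rw [mul_assoc, ← mul_assoc (discretePi N Vk i)]
  congr 2
  unfold relDensity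
  field_simp

theorem gridEntropy_nonneg {d N : ℕ} (hN : 1 ≤ N) (Vk : Fin d → ℝ → ℝ) {U : Idx d N → ℝ}
    (hU : U ∈ PPos d N) : 0 ≤ gridEntropy Vk U := by
  rw [gridEntropy_eq_sum hN Vk hU]
  refine Finset.sum_nonneg fun i _ => mul_nonneg (mul_nonneg (pow_nonneg (mesh_nonneg N) d)
    (discretePi_pos hN Vk i).le) ?_
  have hρ := relDensity_pos hN Vk hU.1 i
  have h := mul_le_mul_of_nonneg_left (Real.one_sub_inv_le_log_of_pos hρ) hρ.le
  rw [mul_sub, mul_inv_cancel₀ hρ.ne'] at h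
  linarith

theorem pinsker {d N : ℕ} (hN : 1 ≤ N) (Vk : Fin d → ℝ → ℝ) {U : Idx d N → ℝ}
    (hU : U ∈ PPos d N) :
    mesh N ^ d * ∑ j, |U j - discretePi N Vk j| ≤ Real.sqrt (2 * gridEntropy Vk U) := by
  have hh := mesh_pos hN
  set w : Idx d N → ℝ := fun i => mesh N ^ d * discretePi N Vk i with hw
  set ρ := relDensity Vk U with hρdef
  have hw0 : ∀ i, 0 < w i := fun i => mul_pos (by positivity) (discretePi_pos hN Vk i)
  have hρ : ∀ i, 0 < ρ i := relDensity_pos hN Vk hU.1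
  have hψ : ∀ i, 0 ≤ ρ i * Real.log (ρ i) - ρ i + 1 := fun i => by
    have h := mul_le_mul_of_nonneg_left (Real.one_sub_inv_le_log_of_pos (hρ i)) (hρ i).le
    rw [mul_sub, mul_inv_cancel₀ (hρ i).ne'] at h
    linarith
  have h1 : mesh N ^ d * ∑ j, |U j - discretePi N Vk j| = ∑ j, w j * |ρ j - 1| := by
    rw [Finset.mul_sum]
    refine Finset.sum_congr rfl fun j _ => ?_
    have hP := discretePi_pos hN Vk j
    have : U j - discretePi N Vk j = discretePi N Vk j * (ρ j - 1) := by
      simp only [hρdef, relDensity]; field_simp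
    rw [this, abs_mul, abs_of_pos hP, hw]
    ring
  rw [h1]
  refine Real.le_sqrt_of_sq_le ?_
  -- Cauchy-Schwarz with the pointwise bound; as `w` and `w ρ` both have total mass one, the first
  -- factor is `2/3 + 4/3 = 2`.
  have hcs := Finset.sum_sq_le_sum_mul_sum_of_sq_le_mul Finset.univ
    (r := fun j => w j * |ρ j - 1|) (f := fun j => w j * ((2 * ρ j + 4) / 3))
    (g := fun j => w j * (ρ j * Real.log (ρ j) - ρ j + 1))
    (fun j _ => mul_nonneg (hw0 j).le (by have := hρ j; positivity))
    (fun j _ => mul_nonneg (hw0 j).le (hψ j))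
    (fun j _ => by
      rw [mul_pow, sq_abs]
      have := mul_le_mul_of_nonneg_left (sq_sub_one_le_pinsker (hρ j)) (sq_nonneg (w j))
      linarith)
  have h2 : ∑ j, w j * ((2 * ρ j + 4) / 3) = 2 := by
    have e : ∀ j, w j * ((2 * ρ j + 4) / 3) = 2 / 3 * (w j * ρ j) + 4 / 3 * w j := fun j => by ring
    simp only [e, Finset.sum_add_distrib, ← Finset.mul_sum]
    have e1 : ∑ j, w j * ρ j = 1 := sum_relDensity hN Vk hU
    have e2 : ∑ j, w j = 1 := sum_mesh_mul_discretePi hN Vk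
    rw [e1, e2]; norm_num
  rwa [h2, ← gridEntropy_eq_sum hN Vk hU] at hcs

/-! ### Vanishing Fisher information forces convergence to the steady state -/

theorem sq_sub_le_mul_fisherDensity {a b M : ℝ} (ha : 0 < a) (hb : 0 < b) (haM : a ≤ M)
    (hbM : b ≤ M) : (a - b) ^ 2 ≤ M * fisherDensity a b := by
  wlog h : b ≤ a generalizing a b
  · have := this hb ha hbM haM (le_of_not_ge h)
    rw [fisherDensity_comm]
    nlinarith [this]
  have h1 : 1 - (a / b)⁻¹ ≤ Real.log a - Real.log b := by
    rw [← Real.log_div ha.ne' hb.ne']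
    exact Real.one_sub_inv_le_log_of_pos (by positivity)
  have h2 : (a - b) ^ 2 ≤ a * fisherDensity a b := by
    calc (a - b) ^ 2 = a * ((a - b) * (1 - (a / b)⁻¹)) := by field_simp
      _ ≤ a * ((a - b) * (Real.log a - Real.log b)) := by
        have : 0 ≤ a - b := by linarith
        gcongr
  exact h2.trans (mul_le_mul_of_nonneg_right haM (fisherDensity_nonneg ha hb))

open Filter Function in
theorem tendsto_gridEntropy {d N : ℕ} (hN : 1 ≤ N) (Vk : Fin d → ℝ → ℝ) {U : ℝ → Idx d N → ℝ}
    (hU : ∀ t, 0 ≤ t → U t ∈ PPos d N)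
    (hI : Tendsto (fun t => gridFisher Vk (U t)) atTop (nhds 0)) :
    Tendsto (fun t => gridEntropy Vk (U t)) atTop (nhds 0) := by
  have hh := mesh_pos hN
  have hP := discretePi_pos hN Vk
  set w : Idx d N → ℝ := fun i => mesh N ^ d * discretePi N Vk i with hw
  have hw0 : ∀ i, 0 < w i := fun i => mul_pos (by positivity) (hP i)
  set M : ℝ := ∑ i, (w i)⁻¹ with hM
  have hmass : ∀ t, 0 ≤ t → ∀ i, mesh N ^ d * U t i ≤ 1 := by
    intro t ht i
    rw [← (hU t ht).2, Finset.mul_sum]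
    exact Finset.single_le_sum (f := fun i => mesh N ^ d * U t i)
      (fun j _ => mul_nonneg (by positivity) ((hU t ht).1 j).le) (Finset.mem_univ i)
  have hbound : ∀ t, 0 ≤ t → ∀ i, relDensity Vk (U t) i ≤ M := by
    intro t ht i
    -- One cell carries at most the total mass: `w i * ρ i = h^d U i ≤ 1`. Summing the reciprocals
    -- gives a bound uniform in `i` and `t`.
    have h1 : relDensity Vk (U t) i ≤ (w i)⁻¹ := by
      rw [le_inv_comm₀ (relDensity_pos hN Vk (hU t ht).1 i) (hw0 i), relDensity, inv_div,
        le_div_iff₀ ((hU t ht).1 i)]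
      have := mul_le_mul_of_nonneg_right (hmass t ht i) (hP i).le
      simp only [hw]
      linarith
    exact h1.trans (Finset.single_le_sum (f := fun i => (w i)⁻¹)
      (fun j _ => (inv_pos.2 (hw0 j)).le) (Finset.mem_univ i))
  let R : Idx d N → Idx d N → Prop := fun i j =>
    Tendsto (fun t => relDensity Vk (U t) i - relDensity Vk (U t) j) atTop (nhds 0)
  have Rrefl : ∀ i, R i i := fun i => by simp [R]
  have Rsymm : ∀ {i j}, R i j → R j i := fun {i j} h => by
    have := h.neg
    simpa [R] using this
  have Rtrans : ∀ {i j k}, R i j → R j k → R i k := fun {i j k} h h' => by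
    have := h.add h'
    simpa [R] using this
  have Rnbh : ∀ i j, Nbh i j → R i j := by
    intro i j hij
    have hc : 0 < conductance Vk i j := by
      unfold conductance
      rw [if_pos hij]
      exact div_pos (Real.sqrt_pos.2 (mul_pos (hP i) (hP j))) (by positivity)
    set C : ℝ := M * ((mesh N ^ d * (1 / 2 * conductance Vk i j))⁻¹) with hC
    have hsq : ∀ t, 0 ≤ t → (relDensity Vk (U t) i - relDensity Vk (U t) j) ^ 2 ≤
        C * gridFisher Vk (U t) := by
      intro t ht
      have hρ := relDensity_pos hN Vk (hU t ht).1
      have hM0 : 0 ≤ M := (hρ i).le.trans (hbound t ht i)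
      refine (sq_sub_le_mul_fisherDensity (hρ i) (hρ j) (hbound t ht i) (hbound t ht j)).trans ?_
      rw [hC, mul_assoc]
      refine mul_le_mul_of_nonneg_left ?_ hM0
      rw [inv_mul_eq_div, le_div_iff₀ (by positivity)]
      unfold gridFisher
      have hnn : ∀ i j, 0 ≤ conductance Vk i j *
          fisherDensity (relDensity Vk (U t) i) (relDensity Vk (U t) j) := fun i j =>
        mul_nonneg (conductance_nonneg Vk i j) (fisherDensity_nonneg (hρ i) (hρ j))
      have h1 : conductance Vk i j *
          fisherDensity (relDensity Vk (U t) i) (relDensity Vk (U t) j) ≤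
          ∑ i, ∑ j, conductance Vk i j *
            fisherDensity (relDensity Vk (U t) i) (relDensity Vk (U t) j) :=
        (Finset.single_le_sum (f := fun j => conductance Vk i j *
          fisherDensity (relDensity Vk (U t) i) (relDensity Vk (U t) j))
          (fun j _ => hnn i j) (Finset.mem_univ j)).trans
        (Finset.single_le_sum (f := fun i => ∑ j, conductance Vk i j *
          fisherDensity (relDensity Vk (U t) i) (relDensity Vk (U t) j))
          (fun i _ => Finset.sum_nonneg fun j _ => hnn i j) (Finset.mem_univ i))
      calc _ = mesh N ^ d * (1 / 2 * (conductance Vk i j *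
          fisherDensity (relDensity Vk (U t) i) (relDensity Vk (U t) j))) := by ring
        _ ≤ _ := by gcongr
    have hlim : Tendsto (fun t => C * gridFisher Vk (U t)) atTop (nhds 0) := by
      simpa using hI.const_mul C
    have hsq0 : Tendsto (fun t => (relDensity Vk (U t) i - relDensity Vk (U t) j) ^ 2) atTop
        (nhds 0) :=
      squeeze_zero' (Eventually.of_forall fun t => sq_nonneg _)
        ((eventually_ge_atTop 0).mono hsq) hlim
    have := hsq0.sqrt
    simp only [Real.sqrt_sq_eq_abs, Real.sqrt_zero] at this
    exact (tendsto_zero_iff_abs_tendsto_zero _).2 this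
  have Rzero : ∀ (i : Idx d N) (k : Fin d) (n : ℕ) (hn : n < N),
      R (update i k ⟨0, hN⟩) (update i k ⟨n, hn⟩) := by
    intro i k n
    induction n with
    | zero => exact fun _ => Rrefl _
    | succ n ih =>
      intro hn
      refine Rtrans (ih (by omega)) ?_
      have h := nbh_update (update i k (⟨n, by omega⟩ : Fin N)) k (b := ⟨n + 1, hn⟩)
        (by rw [update_self]; exact Or.inl rfl)
      rw [update_idem] at h
      exact Rnbh _ _ h
  have Rupd : ∀ (i : Idx d N) (k : Fin d) (b : Fin N), R i (update i k b) := by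
    intro i k b
    have h1 := Rzero i k (i k) (i k).2
    have h2 := Rzero i k b b.2
    simp only [Fin.eta, update_eq_self] at h1 h2
    exact Rtrans (Rsymm h1) h2
  have Rall : ∀ i j, R i j := by
    intro i j
    -- The grid is connected: `i` is turned into `j` one coordinate at a time.
    have key : ∀ s : Finset (Fin d), R i (s.piecewise j i) := by
      intro s
      induction s using Finset.induction_on with
      | empty => rw [Finset.piecewise_empty]; exact Rrefl i
      | insert k s hk ih =>
        rw [Finset.piecewise_insert]
        exact Rtrans ih (Rupd _ _ _)
    simpa using key Finset.univ
  have hone : ∀ i, Tendsto (fun t => relDensity Vk (U t) i - 1) atTop (nhds 0) := by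
    intro i
    -- The `w`-average of the relative density is one, so asymptotically equal values must tend to
    -- one.
    have h1 : Tendsto (fun t => ∑ j, w j * (relDensity Vk (U t) i - relDensity Vk (U t) j)) atTop
        (nhds (∑ j, w j * 0)) :=
      tendsto_finsetSum _ fun j _ => (Rall i j).const_mul (w j)
    simp only [mul_zero, Finset.sum_const_zero] at h1
    refine h1.congr' ((eventually_ge_atTop 0).mono fun t ht => ?_)
    simp only [mul_sub, Finset.sum_sub_distrib, ← Finset.sum_mul]
    rw [sum_relDensity hN Vk (hU t ht), sum_mesh_mul_discretePi hN, one_mul]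
  have hsum : Tendsto (fun t => ∑ i, |relDensity Vk (U t) i - 1|) atTop (nhds 0) := by
    have h1 : Tendsto (fun t => ∑ i, |relDensity Vk (U t) i - 1|) atTop
        (nhds (∑ _i : Idx d N, |(0 : ℝ)|)) := tendsto_finsetSum _ fun i _ => (hone i).abs
    simpa using h1
  refine squeeze_zero' ((eventually_ge_atTop 0).mono fun t ht => gridEntropy_nonneg hN Vk (hU t ht))
    ((eventually_ge_atTop 0).mono fun t ht => ?_) hsum
  unfold gridEntropy
  rw [Finset.mul_sum]
  refine Finset.sum_le_sum fun i _ => ?_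
  have hρ := relDensity_pos hN Vk (hU t ht).1 i
  have hm0 : 0 ≤ mesh N ^ d * U t i := mul_nonneg (by positivity) ((hU t ht).1 i).le
  calc mesh N ^ d * (U t i * Real.log (relDensity Vk (U t) i))
      = mesh N ^ d * U t i * Real.log (relDensity Vk (U t) i) := by ring
    _ ≤ mesh N ^ d * U t i * |relDensity Vk (U t) i - 1| :=
        mul_le_mul_of_nonneg_left ((Real.log_le_sub_one_of_pos hρ).trans (le_abs_self _)) hm0
    _ ≤ 1 * |relDensity Vk (U t) i - 1| :=
        mul_le_mul_of_nonneg_right (hmass t ht i) (abs_nonneg _)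
    _ = _ := one_mul _

/-! ### Decay estimates for second-order gradient flows -/

theorem antitoneOn_Ici_of_hasDerivWithinAt {f f' : ℝ → ℝ}
    (hf : ∀ t, 0 ≤ t → HasDerivWithinAt f (f' t) (Set.Ici 0) t) (hf' : ∀ t, 0 ≤ t → f' t ≤ 0) :
    AntitoneOn f (Set.Ici 0) := by
  have hi : ∀ t ∈ interior (Set.Ici (0 : ℝ)), 0 ≤ t ∧ HasDerivAt f (f' t) t := by
    intro t ht
    have ht' : 0 < t := by rwa [interior_Ici] at ht
    exact ⟨ht'.le, (hf t ht'.le).hasDerivAt (Ici_mem_nhds ht')⟩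
  exact antitoneOn_of_deriv_nonpos (convex_Ici 0) (fun t ht => (hf t ht).continuousWithinAt)
    (fun t ht => (hi t ht).2.differentiableAt.differentiableWithinAt)
    (fun t ht => by rw [(hi t ht).2.deriv]; exact hf' t (hi t ht).1)

theorem exp_decay_of_hasDerivWithinAt {f f' : ℝ → ℝ} {c : ℝ}
    (hf : ∀ t, 0 ≤ t → HasDerivWithinAt f (f' t) (Set.Ici 0) t)
    (hf' : ∀ t, 0 ≤ t → f' t ≤ -(c * f t)) {t t' : ℝ} (ht' : 0 ≤ t') (htt : t' ≤ t) :
    f t ≤ f t' * Real.exp (-(c * (t - t'))) := by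
  have hexp : ∀ t, HasDerivWithinAt (fun t => Real.exp (c * t)) (Real.exp (c * t) * (c * 1))
      (Set.Ici 0) t := fun t => (((hasDerivAt_id t).const_mul c).exp).hasDerivWithinAt
  have hanti := antitoneOn_Ici_of_hasDerivWithinAt (fun t ht => (hf t ht).mul (hexp t))
    (fun t ht => by
      have := mul_le_mul_of_nonneg_right (hf' t ht) (Real.exp_pos (c * t)).le
      linarith)
  have h := hanti ht' (ht'.trans htt) htt
  simp only [Pi.mul_apply] at h
  rw [show -(c * (t - t')) = c * t' - c * t by ring, Real.exp_sub, ← mul_div_assoc,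
    le_div_iff₀ (Real.exp_pos _)]
  exact h

open Filter in
/-- Along the gradient flow of the dissipation `I` of a functional `H` that decays with rate `κ`,
both `H` and `I` decay with rate `κ²`. Here `b` and `c` are the dissipations of `H` and `I`. -/
theorem decay_of_dissipation {H I b c : ℝ → ℝ} {κ : ℝ} (hκ : 0 < κ)
    (hH : ∀ t, 0 ≤ t → HasDerivWithinAt H (-b t) (Set.Ici 0) t)
    (hI : ∀ t, 0 ≤ t → HasDerivWithinAt I (-c t) (Set.Ici 0) t)
    (hH0 : ∀ t, 0 ≤ t → 0 ≤ H t) (hI0 : ∀ t, 0 ≤ t → 0 ≤ I t)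
    (hb : ∀ t, 0 ≤ t → κ * I t ≤ b t)
    (hpsd : ∀ t, 0 ≤ t → 0 ≤ c t - 2 * κ * b t + κ ^ 2 * I t)
    (hlim : Tendsto I atTop (nhds 0) → Tendsto H atTop (nhds 0)) :
    (∀ t t' : ℝ, 0 ≤ t' → t' ≤ t → H t ≤ H t' * Real.exp (-(κ ^ 2 * (t - t'))) ∧
      I t ≤ I t' * Real.exp (-(κ ^ 2 * (t - t')))) ∧
    ∀ t : ℝ, 0 < t → I t ≤ H 0 * (κ * t)⁻¹ := by
  have hκb : ∀ t, 0 ≤ t → κ ^ 2 * I t ≤ κ * b t := fun t ht => by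
    have := mul_le_mul_of_nonneg_left (hb t ht) hκ.le
    linarith
  have hcb : ∀ t, 0 ≤ t → κ * b t ≤ c t := fun t ht => by
    linarith [hκb t ht, hpsd t ht]
  have hcI : ∀ t, 0 ≤ t → κ ^ 2 * I t ≤ c t := fun t ht => (hκb t ht).trans (hcb t ht)
  have hIdecay : ∀ t t' : ℝ, 0 ≤ t' → t' ≤ t → I t ≤ I t' * Real.exp (-(κ ^ 2 * (t - t'))) :=
    fun t t' ht' htt => exp_decay_of_hasDerivWithinAt hI
      (fun t ht => neg_le_neg (hcI t ht)) ht' htt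
  have hIlim : Tendsto I atTop (nhds 0) := by
    have h1 : Tendsto (fun t : ℝ => I 0 * Real.exp (-(κ ^ 2 * (t - 0)))) atTop (nhds 0) := by
      have h2 : Tendsto (fun t : ℝ => κ ^ 2 * (t - 0)) atTop atTop := by
        simp only [sub_zero]
        exact tendsto_id.const_mul_atTop (by positivity)
      simpa using (Real.tendsto_exp_neg_atTop_nhds_zero.comp h2).const_mul (I 0)
    exact squeeze_zero' ((eventually_ge_atTop 0).mono hI0)
      ((eventually_ge_atTop 0).mono fun t ht => hIdecay t 0 le_rfl ht) h1
  have hHlim := hlim hIlim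
  -- A logarithmic Sobolev inequality along the solution: `I - κ H` is nonincreasing with limit `0`,
  -- hence nonnegative.
  have hlsi : ∀ t, 0 ≤ t → κ * H t ≤ I t := by
    have hanti := antitoneOn_Ici_of_hasDerivWithinAt
      (fun t ht => (hI t ht).sub ((hH t ht).const_mul κ))
      (fun t ht => by linarith [hcb t ht])
    intro t ht
    have hl : Tendsto (fun s => I s - κ * H s) atTop (nhds 0) := by
      simpa using hIlim.sub (hHlim.const_mul κ)
    have := le_of_tendsto hl ((eventually_ge_atTop t).mono fun s hs =>
      hanti ht (ht.trans hs) hs)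
    simp only [Pi.sub_apply] at this
    linarith
  refine ⟨fun t t' ht' htt => ⟨exp_decay_of_hasDerivWithinAt hH (fun t ht => ?_) ht' htt,
    hIdecay t t' ht' htt⟩, fun t ht => ?_⟩
  · have := mul_le_mul_of_nonneg_left (hlsi t ht) hκ.le
    linarith [hb t ht]
  -- The monotone quantity is `H + κ t I`, with derivative `-b + κ I - κ t c ≤ 0`; comparison with
  -- time `0` bounds `κ t I(t)` by `H(0)`.
  · have hanti := antitoneOn_Ici_of_hasDerivWithinAt
      (fun t ht => (hH t ht).add (((hasDerivAt_id t).const_mul κ).hasDerivWithinAt.mul (hI t ht)))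
      (fun t ht => by
        have h1 : 0 ≤ κ * t * c t := mul_nonneg (by positivity)
          ((mul_nonneg (sq_nonneg κ) (hI0 t ht)).trans (hcI t ht))
        simp only [id]
        linarith [hb t ht])
    have h := hanti Set.self_mem_Ici ht.le ht.le
    simp only [Pi.add_apply, Pi.mul_apply, id, mul_zero, zero_mul, add_zero] at h
    rw [← div_eq_mul_inv, le_div_iff₀ (by positivity)]
    linarith [hH0 t ht.le]

/-! ### The discrete convexity modulus -/

theorem lambdaH_pos {lam h : ℝ} (hlam : 0 < lam) (hh : 0 < h) : 0 < lambdaH lam h := by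
  unfold lambdaH
  refine mul_pos (by positivity) (sub_pos.2 (Real.exp_lt_one_iff.2 ?_))
  have : 0 < h ^ 2 / 2 * lam := by positivity
  linarith

theorem lambdaH_sub_isBigO {lam : ℝ} (hlam : 0 < lam) :
    (fun h : ℝ => lambdaH lam h - lam) =O[nhdsWithin 0 (Set.Ioi 0)] (fun h : ℝ => h ^ 2) := by
  -- With `x = h² λ / 2`, the error is `(2 / h²) |exp (-x) - 1 + x| ≤ (2 / h²) x² = (λ² / 2) h²` as
  -- soon as `x ≤ 1`.
  refine Asymptotics.IsBigO.of_bound (lam ^ 2 / 2) ?_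
  have hsmall : ∀ᶠ h : ℝ in nhdsWithin 0 (Set.Ioi 0), h ^ 2 / 2 * lam < 1 := by
    refine Filter.Eventually.filter_mono nhdsWithin_le_nhds ?_
    have hc : Continuous fun h : ℝ => h ^ 2 / 2 * lam := by fun_prop
    exact hc.continuousAt.eventually_lt continuousAt_const (by simp)
  filter_upwards [hsmall, self_mem_nhdsWithin] with h h1 hpos
  have hpos : 0 < h := hpos
  set x := h ^ 2 / 2 * lam with hx
  have hx0 : 0 < x := by positivity
  have h2 := Real.abs_exp_sub_one_sub_id_le (x := -x) (by rw [abs_neg, abs_of_pos hx0]; exact h1.le)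
  have h3 : lambdaH lam h - lam = -(2 / h ^ 2 * (Real.exp (-x) - 1 - -x)) := by
    unfold lambdaH
    rw [← hx]
    have : lam = 2 / h ^ 2 * x := by rw [hx]; field_simp
    nth_rewrite 1 [this]
    ring
  rw [h3, norm_neg, Real.norm_eq_abs, abs_mul,
    abs_of_pos (show 0 < 2 / h ^ 2 by positivity), Real.norm_eq_abs,
    abs_of_pos (show 0 < h ^ 2 by positivity)]
  calc 2 / h ^ 2 * |Real.exp (-x) - 1 - -x| ≤ 2 / h ^ 2 * (-x) ^ 2 := by gcongr
    _ = lam ^ 2 / 2 * h ^ 2 := by rw [hx]; field_simp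

/-! ### Decay along the gradient flow of the discrete Fisher information -/

theorem pairing_neg {d N : ℕ} (P Q : Idx d N → ℝ) : pairing P (-Q) = -pairing P Q := by
  simp [pairing]

theorem gridFisher_nonneg {d N : ℕ} (hN : 1 ≤ N) (Vk : Fin d → ℝ → ℝ) {U : Idx d N → ℝ}
    (hU : ∀ i, 0 < U i) : 0 ≤ gridFisher Vk U := by
  rw [← onsagerForm_entropyGrad hN Vk hU]
  exact onsagerForm_self_nonneg hN Vk hU _

/-- Decay along the gradient flow of the discrete Fisher information. -/
theorem fisherFlow_decay {d N : ℕ} (hN : 1 ≤ N) {V : EuclideanSpace ℝ (Fin d) → ℝ}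
    {Vk : Fin d → ℝ → ℝ} {lam : ℝ} (hV : ContDiffOn ℝ 2 V (unitCube d)) (hsep : IsSeparable V Vk)
    (hlam : 0 < lam) (hconv : IsLambdaConvex V lam) {U : ℝ → Idx d N → ℝ}
    (hflow : IsFisherFlow V Vk U) :
    (∀ t t' : ℝ, 0 ≤ t' → t' ≤ t →
      gridEntropy Vk (U t) ≤ gridEntropy Vk (U t') *
        Real.exp (-((2 * lambdaH lam (mesh N)) ^ 2 * (t - t'))) ∧
      gridFisher Vk (U t) ≤ gridFisher Vk (U t') *
        Real.exp (-((2 * lambdaH lam (mesh N)) ^ 2 * (t - t')))) ∧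
    ∀ t : ℝ, 0 < t →
      gridFisher Vk (U t) ≤ gridEntropy Vk (U 0) * (2 * lambdaH lam (mesh N) * t)⁻¹ := by
  have hmem : ∀ t, 0 ≤ t → U t ∈ PPos d N := fun t ht => (hflow t ht).1
  have hder : ∀ t, 0 ≤ t → ∀ i, HasDerivWithinAt (fun τ => U τ i)
      ((-onsager Vk (U t) (gridFisherGrad Vk (U t))) i) (Set.Ici 0) t := by
    intro t ht
    have h := (hflow t ht).2
    rw [onsager_differential_fisherH hN hV.continuousOn hsep (hmem t ht)] at h
    exact hasDerivWithinAt_pi.1 h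
  refine decay_of_dissipation (H := fun t => gridEntropy Vk (U t))
    (I := fun t => gridFisher Vk (U t))
    (b := fun t => onsagerForm Vk (U t) (gridFisherGrad Vk (U t)) (gridEntropyGrad Vk (U t)))
    (c := fun t => onsagerForm Vk (U t) (gridFisherGrad Vk (U t)) (gridFisherGrad Vk (U t)))
    (mul_pos two_pos (lambdaH_pos hlam (mesh_pos hN))) ?_ ?_
    (fun t ht => gridEntropy_nonneg hN Vk (hmem t ht))
    (fun t ht => gridFisher_nonneg hN Vk (hmem t ht).1)
    (fun t ht => fisher_le_onsagerForm hN Vk (hmem t ht).1 hlam.le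
      (avgV_second_difference hN hV hsep hconv))
    ?_ (tendsto_gridEntropy hN Vk hmem)
  · intro t ht
    have h := hasDerivWithinAt_gridEntropy hN Vk (hder t ht) (hmem t ht).1
    rwa [pairing_neg, pairing_onsager, onsagerForm_comm] at h
  · intro t ht
    have h := hasDerivWithinAt_gridFisher hN Vk (hder t ht) (hmem t ht).1
    rwa [pairing_neg, pairing_onsager] at h
  · intro t ht
    -- Positivity of the Onsager operator at `DI - κ DH`, expanded into the quadratic inequality
    -- between `c`, `b` and `I`.
    have h := onsagerForm_self_nonneg hN Vk (hmem t ht).1 (fun i => gridFisherGrad Vk (U t) i -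
      2 * lambdaH lam (mesh N) * gridEntropyGrad Vk (U t) i)
    rwa [onsagerForm_sub_smul, onsagerForm_entropyGrad hN Vk (hmem t ht).1] at h

end QDD

theorem theorem1 (d : ℕ) (hd : 1 ≤ d)
    (V W : EuclideanSpace ℝ (Fin d) → ℝ) (Vk : Fin d → ℝ → ℝ) (lam : ℝ)
    (hV : ContDiffOn ℝ 2 V (QDD.unitCube d))
    (hVW : QDD.PotentialsRelated V W)
    (hsep : QDD.IsSeparable V Vk)
    (hlam : 0 < lam) (hconv : QDD.IsLambdaConvex V lam) :
    (∀ N : ℕ, 1 ≤ N → ∀ U : ℝ → QDD.Idx d N → ℝ, QDD.IsFisherFlow V Vk U →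
      (∀ t t' : ℝ, 0 ≤ t' → t' ≤ t →
        QDD.entropyH V Vk (U t) ≤ QDD.entropyH V Vk (U t')
          * Real.exp (-((2 * QDD.lambdaH lam (QDD.mesh N)) ^ 2 * (t - t'))) ∧
        QDD.fisherH V Vk (U t) ≤ QDD.fisherH V Vk (U t')
          * Real.exp (-((2 * QDD.lambdaH lam (QDD.mesh N)) ^ 2 * (t - t')))) ∧
      (∀ t : ℝ, 0 < t →
        QDD.fisherH V Vk (U t) ≤
          QDD.entropyH V Vk (U 0) * (2 * QDD.lambdaH lam (QDD.mesh N) * t)⁻¹) ∧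
      (∀ t : ℝ, 0 ≤ t →
        ∫ x in QDD.unitCube d,
            |QDD.pcFun (U t) x - QDD.pcFun (QDD.discretePi N Vk) x| ≤
          Real.sqrt (2 * QDD.entropyH V Vk (U 0))
            * Real.exp (-(2 * QDD.lambdaH lam (QDD.mesh N) ^ 2 * t)))) ∧
    (fun h : ℝ => QDD.lambdaH lam h - lam) =O[nhdsWithin 0 (Set.Ioi 0)] (fun h : ℝ => h ^ 2) := by
  refine ⟨fun N hN U hflow => ?_, QDD.lambdaH_sub_isBigO hlam⟩
  have hmem : ∀ t, 0 ≤ t → U t ∈ QDD.PPos d N := fun t ht => (hflow t ht).1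
  have hH : ∀ t, 0 ≤ t → QDD.entropyH V Vk (U t) = QDD.gridEntropy Vk (U t) := fun t ht =>
    QDD.entropyH_eq hN hV.continuousOn hsep (hmem t ht)
  have hI : ∀ t, 0 ≤ t → QDD.fisherH V Vk (U t) = QDD.gridFisher Vk (U t) := fun t ht =>
    QDD.fisherH_eq hN hV.continuousOn hsep (hmem t ht)
  obtain ⟨hdecay, hreg⟩ := QDD.fisherFlow_decay hN hV hsep hlam hconv hflow
  refine ⟨fun t t' ht' htt => ?_, fun t ht => ?_, fun t ht => ?_⟩
  · rw [hH t (ht'.trans htt), hH t' ht', hI t (ht'.trans htt), hI t' ht']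
    exact hdecay t t' ht' htt
  · rw [hI t ht.le, hH 0 le_rfl]
    exact hreg t ht
  · rw [QDD.integral_abs_pcFun_sub hN, hH 0 le_rfl]
    refine (QDD.pinsker hN Vk (hmem t ht)).trans ?_
    have h := (hdecay t 0 le_rfl ht).1
    have h0 := QDD.gridEntropy_nonneg hN Vk (hmem 0 le_rfl)
    refine Real.sqrt_le_iff.2 ⟨by positivity, ?_⟩
    rw [mul_pow, Real.sq_sqrt (by positivity), ← Real.exp_nat_mul]
    -- Pinsker's square root halves the entropy rate: `(2 λʰ)² / 2 = 2 (λʰ)²`.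
    have e : ((2 : ℕ) : ℝ) * -(2 * QDD.lambdaH lam (QDD.mesh N) ^ 2 * t) =
        -((2 * QDD.lambdaH lam (QDD.mesh N)) ^ 2 * (t - 0)) := by push_cast; ring
    rw [e]
    linarith
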